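/- Let $(a_k)_{k\ge1}$ be any sequence of strictly positive real numbers and $\mu=\sum_{k\ge 1}a_k\delta_k$ on $\mathbb N=\{1,2,3,\dots\}$. Let $I=(0,\infty)$, $dm=2x^2\,dx$ on $I$, and let $\mathcal E$ be the (three-dimensional) Bessel Dirichlet form on $L^2(I,m)$: its domain $\mathcal D$ consists of the locally absolutely continuous $u\in L^2(I,m)$ with $\int_0^\infty u'(x)^2x^2\,dx<\infty$, and $\mathcal E[u]=\int_0^\infty u'(x)^2x^2\,dx$. Put $\mathcal E_\lambda=\mathcal E+\lambda\langle\cdot,\cdot\rangle_{L^2(I,m)}$ for $\lambda>0$. Let $J$ be the restriction operator $Ju=u|_{\mathbb N}$ with domain $D(J)=\{u\in\mathcal D:\sum_k a_ku(k)^2<\infty\}$ and values in $\ell^2(\mathbb N,\mu)$, let $P_\lambda$ be the $\mathcal E_\lambda$-orthogonal projection of $\mathcal D$ onto the $\mathcal E_\lambda$-orthogonal complement of $\ker J=\{u\in\mathcal D: u(k)=0\ \forall k\in\mathbb N\}$, and let $\check{\mathcal E}_\lambda$ be the form on $\ell^2(\mathbb N,\mu)$ with domain $\operatorname{ran}J$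 given by $\check{\mathcal E}_\lambda[Ju]=\mathcal E_\lambda[P_\lambda u]$, $u\in D(J)$ (and $\check{\mathcal E}_\lambda=\infty$ outside $\operatorname{ran}J$). Theorem. As $\lambda\downarrow0$ the forms $\check{\mathcal E}_\lambda$ have a unique Mosco limit $\check{\mathcal E}$ in $\ell^2(\mathbb N,\mu)$ (the trace of $\mathcal E$ with respect to $\mu$). It is a Dirichlet form, and it is irreducible and transient, that is: (i) (irreducibility) if $A\subset\mathbb N$ is invariant, i.e. for every $u\in\check{\mathcal D}:=D(\check{\mathcal E})$ one has $\mathbf 1_Au,\ \mathbf 1_{A^c}u\in\check{\mathcal D}$ and $\check{\mathcal E}[u]=\check{\mathcal E}[\mathbf 1_Au]+\check{\mathcal E}[\mathbf 1_{A^c}u]$, then $\mu(A)=0$ or $\mu(A^c)=0$ (equivalently $A=\emptyset$ or $A=\mathbb N$); (ii) (transience) there is a bounded, $\mu$-integrable, strictly positive function $g$ on $\mathbb N$ such that $\int_{\mathbb N}|u|\,g\,d\mu\le\sqrt{\check{\mathcal E}[u]}$ for all $u\in\check{\mathcal D}$. -/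

import Mathlib

open MeasureTheory Set Filter Topology
open scoped ENNReal

noncomputable section

/-! ### Dirichlet forms on `L²(X, m)`

A quadratic form is described by its extended energy functional `q : L²(X, m) → [0, ∞]`;
its domain is `{u | q u < ∞}`. -/

section Forms

variable {X : Type*} [MeasurableSpace X] {m : Measure X}

/-- `q` is a (symmetric) Dirichlet form: a densely defined nonnegative quadratic form which is closed
(equivalently, its extended energy functional is lower semicontinuous) and on which the
unit contraction operates. -/
structure IsDirichletForm (q : Lp ℝ 2 m → ℝ≥0∞) : Prop where
  smul : ∀ (c : ℝ) (u : Lp ℝ 2 m), q (c • u) = ENNReal.ofReal (c ^ 2) * q u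
  parallelogram : ∀ u v : Lp ℝ 2 m, q (u + v) + q (u - v) = 2 * q u + 2 * q v
  dense : Dense {u : Lp ℝ 2 m | q u < ∞}
  closed : LowerSemicontinuous q
  markov : ∀ u v : Lp ℝ 2 m, v =ᵐ[m] (fun x => max 0 (min (u x) 1)) → q v ≤ q u

/-- The function `1_A u`, as an element of `L²(X, m)`. -/
def cutoff (A : Set X) (hA : MeasurableSet A) (u : Lp ℝ 2 m) : Lp ℝ 2 m :=
  ((Lp.memLp u).indicator hA).toLp (A.indicator u)

/-- `A` is invariant for `q`: multiplication by `1_A` preserves the domain, and the form splits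
along `A` and its complement. -/
def IsInvariantSet (q : Lp ℝ 2 m → ℝ≥0∞) (A : Set X) (hA : MeasurableSet A) : Prop :=
  ∀ u : Lp ℝ 2 m, q u < ∞ →
    q (cutoff A hA u) < ∞ ∧ q (cutoff Aᶜ hA.compl u) < ∞ ∧
      q u = q (cutoff A hA u) + q (cutoff Aᶜ hA.compl u)

/-- Irreducibility: every invariant set is null or co-null. -/
def IsIrreducibleForm (q : Lp ℝ 2 m → ℝ≥0∞) : Prop :=
  ∀ (A : Set X) (hA : MeasurableSet A), IsInvariantSet q A hA → m A = 0 ∨ m Aᶜ = 0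

/-- Transience: there is a bounded, integrable, a.e. strictly positive function `g` with
`∫ |u| g dm ≤ √q[u]` for every `u` in the domain (stated in squared form, as an inequality
in `[0, ∞]`; in particular the left side is finite on the domain). -/
def IsTransientForm (q : Lp ℝ 2 m → ℝ≥0∞) : Prop :=
  ∃ g : X → ℝ, Integrable g m ∧ (∃ C : ℝ, ∀ᵐ x ∂m, g x ≤ C) ∧ (∀ᵐ x ∂m, 0 < g x) ∧
    ∀ u : Lp ℝ 2 m, q u < ∞ → (∫⁻ x, ENNReal.ofReal (|u x| * g x) ∂m) ^ 2 ≤ q u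

end Forms

/-- `q` is the Mosco limit of the forms `Q l` as `l ↓ 0`, on a real Hilbert space: along every
sequence of positive numbers tending to zero, the `liminf` inequality holds for weakly
convergent sequences, and every point has a strongly convergent recovery sequence. -/
def IsMoscoLimit {H : Type*} [NormedAddCommGroup H] [InnerProductSpace ℝ H]
    (Q : ℝ → H → ℝ≥0∞) (q : H → ℝ≥0∞) : Prop :=
  ∀ l : ℕ → ℝ, (∀ n, 0 < l n) → Tendsto l atTop (𝓝 0) →
    (∀ (φ : ℕ → H) (φ₀ : H),
      (∀ ψ : H, Tendsto (fun n => inner ℝ (φ n) ψ) atTop (𝓝 (inner ℝ φ₀ ψ))) →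
        q φ₀ ≤ liminf (fun n => Q (l n) (φ n)) atTop) ∧
    (∀ φ₀ : H, ∃ φ : ℕ → H, Tendsto φ atTop (𝓝 φ₀) ∧
      limsup (fun n => Q (l n) (φ n)) atTop ≤ q φ₀)

/-! ### The Bessel Dirichlet form for `n = 3`

Functions on `I = (0, ∞)` are represented by functions `ℝ → ℝ`, of which only the values
on `I` are ever used. -/

/-- The measure `dm = 2 x² dx` on `(0, ∞)`. -/
def besselMeasure : Measure ℝ :=
  (volume.restrict (Ioi (0 : ℝ))).withDensity (fun x => ENNReal.ofReal (2 * x ^ 2))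

/-- The domain `𝒟` of the Bessel form: (locally) absolutely continuous functions on `(0, ∞)`
lying in `L²(I, m)` with `∫ u'(x)² x² dx < ∞`. -/
structure BesselDomain (u : ℝ → ℝ) : Prop where
  ac : ∀ s t : ℝ, 0 < s → s ≤ t → AbsolutelyContinuousOnInterval u s t
  energy : IntegrableOn (fun x => deriv u x ^ 2 * x ^ 2) (Ioi (0 : ℝ))
  memLp : MemLp u 2 besselMeasure

/-- The bilinear form `ℰ_l(u, v) = ∫ u' v' x² dx + l ∫ u v dm`. -/
def besselForm (l : ℝ) (u v : ℝ → ℝ) : ℝ :=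
  (∫ x in Ioi (0 : ℝ), deriv u x * deriv v x * x ^ 2) + l * ∫ x, u x * v x ∂besselMeasure

/-! ### The trace of the Bessel form on `{1, 2, 3, …}` -/

/-- The discrete σ-algebra on the positive integers. -/
instance instMeasurableSpacePosNat : MeasurableSpace ℕ+ := ⊤

instance instDiscreteMeasurableSpacePosNat : DiscreteMeasurableSpace ℕ+ := ⟨fun _ => trivial⟩

/-- The measure `μ = ∑ a_k δ_k` on `{1, 2, 3, …}`. -/
def discreteMeasure (a : ℕ+ → ℝ) : Measure ℕ+ :=
  Measure.sum (fun k => ENNReal.ofReal (a k) • Measure.dirac k)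

/-- The restriction of a function to the positive integers. -/
def restrictNat (u : ℝ → ℝ) : ℕ+ → ℝ := fun k => u (k : ℕ)

/-- The domain of the restriction operator `J : 𝒟 → ℓ²(μ)`. -/
structure DomJ (a : ℕ+ → ℝ) (u : ℝ → ℝ) : Prop where
  mem : BesselDomain u
  sq : MemLp (restrictNat u) 2 (discreteMeasure a)

/-- The kernel of `J`. -/
def KerJ (u : ℝ → ℝ) : Prop := BesselDomain u ∧ ∀ k : ℕ+, restrictNat u k = 0

/-- The `ℰ_l`-orthogonal complement of the kernel of `J` in `𝒟`. -/
def KerJOrth (l : ℝ) (v : ℝ → ℝ) : Prop :=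
  BesselDomain v ∧ ∀ w, KerJ w → besselForm l v w = 0

/-- `v = P_l u`: `v` is the `ℰ_l`-orthogonal projection of `u` onto the orthogonal complement
of the kernel of `J`. -/
def IsProjection (l : ℝ) (u v : ℝ → ℝ) : Prop :=
  KerJOrth l v ∧ ∀ w, KerJOrth l w → besselForm l (fun x => u x - v x) w = 0

/-- The form on `ℓ²(μ)` with domain the range of `J`, given there by `J u ↦ ℰ_l[P_l u]`. The
infimum only serves to select the common value of `ℰ_l[P_l u]` over all `u` with `J u = φ`;
it is `∞` outside the range of `J`. -/
def approxTraceForm (a : ℕ+ → ℝ) (l : ℝ) (φ : Lp ℝ 2 (discreteMeasure a)) : ℝ≥0∞ :=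
  ⨅ (u : ℝ → ℝ) (v : ℝ → ℝ) (h : DomJ a u) (_ : h.sq.toLp (restrictNat u) = φ)
    (_ : IsProjection l u v), ENNReal.ofReal (besselForm l v v)

/-- `q` is the trace of the Bessel form with respect to `μ`: the Mosco limit of the forms
`J u ↦ ℰ_l[P_l u]` as `l ↓ 0`. -/
def IsTraceForm (a : ℕ+ → ℝ) (q : Lp ℝ 2 (discreteMeasure a) → ℝ≥0∞) : Prop :=
  IsMoscoLimit (approxTraceForm a) q

end

noncomputable section

/-! ### The Bessel form -/

/-! The trace form can be computed explicitly: it is `discreteEnergy`, the sum of `((k + 1) φ(k + 1)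
- k φ(k))²` over `k ≥ 0`. The three-dimensional Bessel form turns into the one-dimensional Dirichlet
form under `u ↦ x u`, so harmonic interpolation between integers makes `x u` piecewise linear.

For `λ = κ² / 2`, evaluation at an integer is represented by an explicit resolvent kernel
(`besselForm_resolventKernel`). These kernels are orthogonal to `ker J`, so projection preserves
values at integers (`IsProjection.restrictNat_eq`). Their values at integers invert a tridiagonal
matrix (`resolventProfile_recurrence`), so finite combinations of kernels interpolate prescribed
data, and their energy is the quadratic form of that matrix. As `κ → 0` it tends to a sum of squared
differences (`tendsto_interpolantEnergy`).

For the liminf inequality, any function has at least the energy of a kernel combination with the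
same values at `1, …, N` (`interpolantEnergy_le_besselForm`); let `κ → 0`, then take the supremum
over `N`. For recovery sequences, finitely supported data are interpolated exactly, and a diagonal
argument reduces to them: the limit energy controls `k φ(k)²`, so soft thresholding yields finite
support, and it does not increase the energy.

That last fact, like the Markov property, rests on `partialEnergy_succ_eq`, which rewrites the
energy with nonnegative conductances. Irreducibility holds because neighbouring integers interact
strictly; transience, because the energy bounds every value of `φ` uniformly. -/

/-- The half-line is exhausted by the compact intervals `[1 / (n + 1), n + 1]`. Linearity of the
form depends on this, since `deriv` is additive only at points of differentiability. -/
theorem BesselDomain.ae_differentiableAt {u : ℝ → ℝ} (hu : BesselDomain u) :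
    ∀ᵐ x ∂(volume.restrict (Ioi (0 : ℝ))), DifferentiableAt ℝ u x := by
  have h : ∀ n : ℕ, ∀ᵐ x : ℝ, x ∈ uIcc (1 / ((n : ℝ) + 1)) ((n : ℝ) + 1) →
      DifferentiableAt ℝ u x := fun n =>
    (hu.ac _ _ (by positivity) (by
      rw [div_le_iff₀ (by positivity)]
      nlinarith [(Nat.cast_nonneg n : (0 : ℝ) ≤ n)])).ae_differentiableAt
  rw [ae_restrict_iff' measurableSet_Ioi]
  filter_upwards [ae_all_iff.2 h] with x hx hpos
  obtain ⟨n, hn⟩ := exists_nat_one_div_lt (mem_Ioi.1 hpos)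
  obtain ⟨m, hm⟩ := exists_nat_ge x
  refine hx (max n m) (mem_uIcc.2 (Or.inl ⟨?_, ?_⟩))
  · refine le_trans ?_ hn.le
    gcongr
    exact le_max_left _ _
  · refine hm.trans ?_
    have : (m : ℝ) ≤ ((max n m : ℕ) : ℝ) := by exact_mod_cast le_max_right _ _
    linarith

theorem BesselDomain.memLp_deriv {u : ℝ → ℝ} (hu : BesselDomain u) :
    MemLp (fun x => deriv u x * x) 2 (volume.restrict (Ioi (0 : ℝ))) := by
  have hm : AEStronglyMeasurable (fun x => deriv u x * x) (volume.restrict (Ioi (0 : ℝ))) :=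
    ((measurable_deriv u).mul measurable_id).aestronglyMeasurable
  rw [memLp_two_iff_integrable_sq hm]
  simp only [mul_pow]
  exact hu.energy

theorem BesselDomain.integrable_deriv_mul {u v : ℝ → ℝ} (hu : BesselDomain u)
    (hv : BesselDomain v) : IntegrableOn (fun x => deriv u x * deriv v x * x ^ 2) (Ioi 0) := by
  refine (hu.memLp_deriv.integrable_mul hv.memLp_deriv).congr (Eventually.of_forall fun x => ?_)
  simp only [Pi.mul_apply]
  ring

theorem BesselDomain.integrable_mul {u v : ℝ → ℝ} (hu : BesselDomain u)
    (hv : BesselDomain v) : Integrable (fun x => u x * v x) besselMeasure :=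
  hu.memLp.integrable_mul hv.memLp

theorem BesselDomain.add {u v : ℝ → ℝ} (hu : BesselDomain u) (hv : BesselDomain v) :
    BesselDomain (fun x => u x + v x) where
  ac s t hs hst := (hu.ac s t hs hst).fun_add (hv.ac s t hs hst)
  energy := by
    refine ((hu.memLp_deriv.add hv.memLp_deriv).integrable_sq).congr ?_
    filter_upwards [hu.ae_differentiableAt, hv.ae_differentiableAt] with x h1 h2
    rw [deriv_fun_add h1 h2]
    simp only [Pi.add_apply]
    ring
  memLp := hu.memLp.add hv.memLp

theorem BesselDomain.const_mul {u : ℝ → ℝ} (c : ℝ) (hu : BesselDomain u) :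
    BesselDomain (fun x => c * u x) where
  ac s t hs hst := (hu.ac s t hs hst).const_mul c
  energy := by
    refine (hu.energy.const_mul (c ^ 2)).congr ?_
    filter_upwards [hu.ae_differentiableAt] with x h1
    rw [deriv_const_mul c h1]
    ring
  memLp := hu.memLp.const_mul c

theorem BesselDomain.zero : BesselDomain (fun _ => 0) where
  ac s t _ _ := (LipschitzWith.const (0 : ℝ)).lipschitzOnWith.absolutelyContinuousOnInterval
  energy := by simp
  memLp := MemLp.zero'

theorem BesselDomain.sub {u v : ℝ → ℝ} (hu : BesselDomain u) (hv : BesselDomain v) :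
    BesselDomain (fun x => u x - v x) := by
  simpa [sub_eq_add_neg] using hu.add (hv.const_mul (-1))

theorem BesselDomain.sum {ι : Type*} (s : Finset ι) (c : ι → ℝ) {g : ι → ℝ → ℝ}
    (hg : ∀ i, BesselDomain (g i)) : BesselDomain (fun x => ∑ i ∈ s, c i * g i x) := by
  classical
  induction s using Finset.induction_on with
  | empty => simpa using BesselDomain.zero
  | insert i s hi ih => simpa [Finset.sum_insert hi] using ((hg i).const_mul (c i)).add ih

theorem besselForm_comm (l : ℝ) (u v : ℝ → ℝ) : besselForm l u v = besselForm l v u := by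
  simp only [besselForm, mul_comm (deriv u _), mul_comm (u _)]

theorem besselForm_add_right (l : ℝ) {u v w : ℝ → ℝ} (hu : BesselDomain u) (hv : BesselDomain v)
    (hw : BesselDomain w) :
    besselForm l u (fun x => v x + w x) = besselForm l u v + besselForm l u w := by
  have h1 : ∫ x in Ioi (0 : ℝ), deriv u x * deriv (fun x => v x + w x) x * x ^ 2 =
      (∫ x in Ioi (0 : ℝ), deriv u x * deriv v x * x ^ 2) +
        ∫ x in Ioi (0 : ℝ), deriv u x * deriv w x * x ^ 2 := by
    rw [← integral_add (hu.integrable_deriv_mul hv) (hu.integrable_deriv_mul hw)]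
    refine integral_congr_ae ?_
    filter_upwards [hv.ae_differentiableAt, hw.ae_differentiableAt] with x h1 h2
    rw [deriv_fun_add h1 h2]
    ring
  have h2 : ∫ x, u x * (v x + w x) ∂besselMeasure =
      (∫ x, u x * v x ∂besselMeasure) + ∫ x, u x * w x ∂besselMeasure := by
    rw [← integral_add (hu.integrable_mul hv) (hu.integrable_mul hw)]
    simp only [mul_add]
  simp only [besselForm, h1, h2]
  ring

theorem besselForm_const_mul_right (l c : ℝ) (u : ℝ → ℝ) {v : ℝ → ℝ} (hv : BesselDomain v) :
    besselForm l u (fun x => c * v x) = c * besselForm l u v := by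
  have h1 : ∫ x in Ioi (0 : ℝ), deriv u x * deriv (fun x => c * v x) x * x ^ 2 =
      c * ∫ x in Ioi (0 : ℝ), deriv u x * deriv v x * x ^ 2 := by
    rw [← integral_const_mul]
    refine integral_congr_ae ?_
    filter_upwards [hv.ae_differentiableAt] with x h1
    rw [deriv_const_mul c h1]
    ring
  have h2 : ∫ x, u x * (c * v x) ∂besselMeasure = c * ∫ x, u x * v x ∂besselMeasure := by
    rw [← integral_const_mul]
    congr 1 with x
    ring
  simp only [besselForm, h1, h2]
  ring

theorem besselForm_zero_right (l : ℝ) (u : ℝ → ℝ) : besselForm l u (fun _ => 0) = 0 := by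
  simp [besselForm]

theorem besselForm_sum_right {ι : Type*} (l : ℝ) (s : Finset ι) (c : ι → ℝ) {u : ℝ → ℝ}
    {g : ι → ℝ → ℝ} (hu : BesselDomain u) (hg : ∀ i, BesselDomain (g i)) :
    besselForm l u (fun x => ∑ i ∈ s, c i * g i x) = ∑ i ∈ s, c i * besselForm l u (g i) := by
  classical
  induction s using Finset.induction_on with
  | empty => simpa using besselForm_zero_right l u
  | insert i s hi ih =>
    simp only [Finset.sum_insert hi]
    rw [besselForm_add_right l hu ((hg i).const_mul _) (BesselDomain.sum s c hg), ih,
      besselForm_const_mul_right l _ u (hg i)]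

/-- The form is bounded below along its tangent at `v`. -/
theorem two_mul_besselForm_sub_le {l : ℝ} (hl : 0 ≤ l) {u v : ℝ → ℝ} (hu : BesselDomain u)
    (hv : BesselDomain v) : 2 * besselForm l u v - besselForm l v v ≤ besselForm l u u := by
  have h1 : 2 * (∫ x in Ioi (0 : ℝ), deriv u x * deriv v x * x ^ 2) -
      (∫ x in Ioi (0 : ℝ), deriv v x * deriv v x * x ^ 2) ≤
      ∫ x in Ioi (0 : ℝ), deriv u x * deriv u x * x ^ 2 := by
    rw [← integral_const_mul, ← integral_sub ((hu.integrable_deriv_mul hv).const_mul 2)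
      (hv.integrable_deriv_mul hv)]
    refine integral_mono (((hu.integrable_deriv_mul hv).const_mul 2).sub
      (hv.integrable_deriv_mul hv)) (hu.integrable_deriv_mul hu) fun x => ?_
    simp only
    nlinarith [sq_nonneg ((deriv u x - deriv v x) * x)]
  have h2 : 2 * (∫ x, u x * v x ∂besselMeasure) - (∫ x, v x * v x ∂besselMeasure) ≤
      ∫ x, u x * u x ∂besselMeasure := by
    rw [← integral_const_mul, ← integral_sub ((hu.integrable_mul hv).const_mul 2)
      (hv.integrable_mul hv)]
    refine integral_mono (((hu.integrable_mul hv).const_mul 2).sub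
      (hv.integrable_mul hv)) (hu.integrable_mul hu) fun x => ?_
    simp only
    nlinarith [sq_nonneg (u x - v x)]
  simp only [besselForm]
  nlinarith

/-! ### Weighted integrals and pointwise growth bounds -/

theorem integrable_besselMeasure_iff {f : ℝ → ℝ} :
    Integrable f besselMeasure ↔ IntegrableOn (fun x => 2 * x ^ 2 * f x) (Ioi 0) := by
  rw [besselMeasure, integrable_withDensity_iff_integrable_smul' (by fun_prop)
    (Eventually.of_forall fun x => ENNReal.ofReal_lt_top), IntegrableOn]
  refine integrable_congr (Eventually.of_forall fun x => ?_)
  simp only [smul_eq_mul]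
  rw [ENNReal.toReal_ofReal (by positivity)]

theorem integral_besselMeasure (f : ℝ → ℝ) :
    ∫ x, f x ∂besselMeasure = ∫ x in Ioi (0 : ℝ), 2 * x ^ 2 * f x := by
  rw [besselMeasure, integral_withDensity_eq_integral_toReal_smul (by fun_prop)
    (Eventually.of_forall fun x => ENNReal.ofReal_lt_top)]
  refine integral_congr_ae (Eventually.of_forall fun x => ?_)
  simp only [smul_eq_mul]
  rw [ENNReal.toReal_ofReal (by positivity)]

/-- Split `|u'| = (|u'| x) · x⁻¹` and bound the product by the sum of squares; `x⁻²` integrates to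
`1 / s - 1 / t`. The crude bound suffices, as it serves only to remove boundary terms. -/
theorem BesselDomain.abs_sub_le {u : ℝ → ℝ} (hu : BesselDomain u) {s t : ℝ} (hs : 0 < s)
    (hst : s ≤ t) :
    |u t - u s| ≤ (∫ x in Ioi (0 : ℝ), deriv u x ^ 2 * x ^ 2) + 1 / s := by
  have hac := hu.ac s t hs hst
  have hsub : Ioc s t ⊆ Ioi 0 := fun x hx => hs.trans hx.1
  have hinv : IntervalIntegrable (fun x : ℝ => (x ^ 2)⁻¹) volume s t := by
    refine ContinuousOn.intervalIntegrable (ContinuousOn.inv₀ (by fun_prop) fun x hx => ?_)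
    rw [uIcc_of_le hst] at hx
    have := hs.trans_le hx.1
    positivity
  have hen : IntervalIntegrable (fun x => deriv u x ^ 2 * x ^ 2) volume s t :=
    (intervalIntegrable_iff_integrableOn_Ioc_of_le hst).2 (hu.energy.mono_set hsub)
  have hinvint : ∫ x in s..t, (x ^ 2)⁻¹ = 1 / s - 1 / t := by
    rw [intervalIntegral.integral_eq_sub_of_hasDerivAt (f := fun x => -x⁻¹) ?_ hinv]
    · field_simp; ring
    · intro x hx
      rw [uIcc_of_le hst] at hx
      simpa using (hasDerivAt_inv (hs.trans_le hx.1).ne').fun_neg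
  have hle : ∫ x in s..t, deriv u x ^ 2 * x ^ 2 ≤
      ∫ x in Ioi (0 : ℝ), deriv u x ^ 2 * x ^ 2 := by
    rw [intervalIntegral.integral_of_le hst]
    exact setIntegral_mono_set hu.energy (Eventually.of_forall fun x => by positivity)
      hsub.eventuallyLE
  calc |u t - u s| = ‖∫ x in s..t, deriv u x‖ := by
        rw [hac.integral_deriv_eq_sub, Real.norm_eq_abs]
    _ ≤ ∫ x in s..t, ‖deriv u x‖ := intervalIntegral.norm_integral_le_integral_norm hst
    _ ≤ ∫ x in s..t, (deriv u x ^ 2 * x ^ 2 + (x ^ 2)⁻¹) := by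
        refine intervalIntegral.integral_mono_on hst hac.intervalIntegrable_deriv.norm
          (hen.add hinv) fun x hx => ?_
        have hx0 : 0 < x := hs.trans_le hx.1
        rw [Real.norm_eq_abs]
        have h1 : |deriv u x| = (|deriv u x| * x) * x⁻¹ := by field_simp
        have h2 : deriv u x ^ 2 * x ^ 2 = (|deriv u x| * x) ^ 2 := by rw [mul_pow, sq_abs]
        rw [h1, h2, ← inv_pow]
        nlinarith [sq_nonneg (|deriv u x| * x - x⁻¹), sq_nonneg (|deriv u x| * x),
          sq_nonneg x⁻¹]
    _ = (∫ x in s..t, deriv u x ^ 2 * x ^ 2) + ∫ x in s..t, (x ^ 2)⁻¹ :=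
        intervalIntegral.integral_add hen hinv
    _ ≤ _ := by
        rw [hinvint]
        have : 0 ≤ 1 / t := by
          have := hs.trans_le hst
          positivity
        linarith

theorem BesselDomain.exists_abs_le {u : ℝ → ℝ} (hu : BesselDomain u) :
    ∃ C, 0 ≤ C ∧ ∀ x, 0 < x → |u x| ≤ C + 1 / x := by
  have hE : 0 ≤ ∫ x in Ioi (0 : ℝ), deriv u x ^ 2 * x ^ 2 :=
    integral_nonneg fun x => by positivity
  refine ⟨|u 1| + (∫ x in Ioi (0 : ℝ), deriv u x ^ 2 * x ^ 2) + 1, by positivity,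
    fun x hx => ?_⟩
  have hx' : 0 < 1 / x := by positivity
  rcases le_total x 1 with h | h
  · have h1 := hu.abs_sub_le hx h
    rw [abs_sub_comm] at h1
    have := abs_sub_abs_le_abs_sub (u x) (u 1)
    linarith
  · have h1 := hu.abs_sub_le one_pos h
    have := abs_sub_abs_le_abs_sub (u x) (u 1)
    rw [one_div_one] at h1
    linarith

/-! ### The resolvent kernel and its reproducing property -/

/-- The function `x ↦ x G(x)`, where `G` is a multiple of the resolvent kernel of the Bessel form
with pole at `k` and parameter `κ ^ 2 / 2`. -/
def resolventProfile (κ k x : ℝ) : ℝ :=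
  Real.sinh (κ * min x k) * Real.exp (-κ * max x k)

/-- A multiple of the resolvent kernel of the Bessel form with pole at `k`. -/
def resolventKernel (κ k x : ℝ) : ℝ := resolventProfile κ k x * x⁻¹

section ResolventKernel

variable {κ k x : ℝ}

theorem resolventProfile_of_le (h : x ≤ k) :
    resolventProfile κ k x = Real.sinh (κ * x) * Real.exp (-κ * k) := by
  simp [resolventProfile, h]

theorem resolventProfile_of_ge (h : k ≤ x) :
    resolventProfile κ k x = Real.sinh (κ * k) * Real.exp (-κ * x) := by
  simp [resolventProfile, h]

theorem continuous_resolventProfile (κ k : ℝ) : Continuous (resolventProfile κ k) := by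
  unfold resolventProfile
  fun_prop

theorem resolventProfile_nonneg (hκ : 0 < κ) (hk : 0 ≤ k) (hx : 0 ≤ x) :
    0 ≤ resolventProfile κ k x :=
  mul_nonneg (Real.sinh_nonneg_iff.2 (mul_nonneg hκ.le (le_min hx hk))) (Real.exp_pos _).le

theorem resolventProfile_le (hκ : 0 < κ) (hk : 0 ≤ k) :
    resolventProfile κ k x ≤ Real.sinh (κ * k) * Real.exp (-κ * x) := by
  rcases le_total x k with h | h
  · rw [resolventProfile_of_le h]
    have hs : 0 ≤ Real.sinh (κ * k) := Real.sinh_nonneg_iff.2 (by positivity)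
    refine mul_le_mul ?_ ?_ (Real.exp_pos _).le hs
    · exact Real.sinh_le_sinh.2 (by gcongr)
    · exact Real.exp_le_exp.2 (by nlinarith)
  · rw [resolventProfile_of_ge h]

/-- The derivative is written as flux over `x ^ 2`: on each side of the pole the flux `x² G'` is
given by a function smooth on all of `ℝ`, which is what the integration by parts uses. -/
theorem hasDerivAt_resolventKernel_of_lt (hx : 0 < x) (h : x < k) :
    HasDerivAt (resolventKernel κ k)
      (Real.exp (-κ * k) * (κ * Real.cosh (κ * x) * x - Real.sinh (κ * x)) / x ^ 2) x := by
  have h1 : HasDerivAt (fun y => Real.sinh (κ * y) * Real.exp (-κ * k) * y⁻¹)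
      (Real.cosh (κ * x) * (κ * 1) * Real.exp (-κ * k) * x⁻¹ +
        Real.sinh (κ * x) * Real.exp (-κ * k) * -(x ^ 2)⁻¹) x :=
    ((((hasDerivAt_id x).const_mul κ).sinh).mul_const _).mul (hasDerivAt_inv hx.ne')
  refine (h1.congr_of_eventuallyEq ?_).congr_deriv (by field_simp; ring)
  filter_upwards [Iio_mem_nhds h] with y hy
  rw [resolventKernel, resolventProfile_of_le (mem_Iio.1 hy).le]

theorem hasDerivAt_resolventKernel_of_gt (hx : 0 < x) (h : k < x) :
    HasDerivAt (resolventKernel κ k)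
      (-(Real.sinh (κ * k) * ((κ * x + 1) * Real.exp (-κ * x)) / x ^ 2)) x := by
  have h1 : HasDerivAt (fun y => Real.sinh (κ * k) * Real.exp (-κ * y) * y⁻¹)
      (Real.sinh (κ * k) * (Real.exp (-κ * x) * (-κ * 1)) * x⁻¹ +
        Real.sinh (κ * k) * Real.exp (-κ * x) * -(x ^ 2)⁻¹) x :=
    ((((hasDerivAt_id x).const_mul (-κ)).exp).const_mul _).mul (hasDerivAt_inv hx.ne')
  refine (h1.congr_of_eventuallyEq ?_).congr_deriv (by field_simp; ring)
  filter_upwards [Ioi_mem_nhds h] with y hy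
  rw [resolventKernel, resolventProfile_of_ge (mem_Ioi.1 hy).le]

theorem sinh_le_mul_cosh {y : ℝ} (hy : 0 ≤ y) : Real.sinh y ≤ y * Real.cosh y := by
  have h : MonotoneOn (fun y => y * Real.cosh y - Real.sinh y) (Ici 0) := by
    refine monotoneOn_of_deriv_nonneg (convex_Ici 0) (by fun_prop) (by fun_prop) fun z hz => ?_
    rw [interior_Ici, mem_Ioi] at hz
    have : HasDerivAt (fun y => y * Real.cosh y - Real.sinh y)
        (1 * Real.cosh z + z * Real.sinh z - Real.cosh z) z :=
      ((hasDerivAt_id z).mul (Real.hasDerivAt_cosh z)).sub (Real.hasDerivAt_sinh z)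
    rw [this.deriv]
    have := Real.sinh_pos_iff.2 hz
    nlinarith [mul_pos hz this]
  have := h self_mem_Ici (mem_Ici.2 hy) hy
  simp at this
  linarith

/-- The singularity at zero is harmless: to the left of the pole, `sinh (κ x) / x` lies between `0`
and `κ cosh (κ x)`. The exponential factor then gives square integrability at infinity. -/
theorem abs_deriv_resolventKernel_mul_le (hκ : 0 < κ) (hk : 1 ≤ k) (hx : 0 < x) (hxk : x ≠ k) :
    |deriv (resolventKernel κ k) x * x| ≤
      (κ * Real.cosh (κ * k) + (κ + 1) * Real.sinh (κ * k)) * Real.exp (-κ * x) := by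
  have hk0 : 0 < k := by linarith
  have hs : 0 ≤ Real.sinh (κ * k) := Real.sinh_nonneg_iff.2 (by positivity)
  have hc := Real.cosh_pos (κ * k)
  have he := Real.exp_pos (-κ * x)
  rcases lt_or_gt_of_ne hxk with h | h
  · rw [(hasDerivAt_resolventKernel_of_lt hx h).deriv]
    have e : Real.exp (-κ * k) * (κ * Real.cosh (κ * x) * x - Real.sinh (κ * x)) / x ^ 2 * x =
        Real.exp (-κ * k) * (κ * Real.cosh (κ * x) - Real.sinh (κ * x) / x) := by
      field_simp
    have h1 : Real.sinh (κ * x) / x ≤ κ * Real.cosh (κ * x) := by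
      rw [div_le_iff₀ hx]
      linarith [sinh_le_mul_cosh (show 0 ≤ κ * x by positivity)]
    have h2 : 0 ≤ Real.sinh (κ * x) / x :=
      div_nonneg (Real.sinh_nonneg_iff.2 (by positivity)) hx.le
    have h3 : Real.cosh (κ * x) ≤ Real.cosh (κ * k) := by
      rw [Real.cosh_le_cosh, abs_of_nonneg (by positivity), abs_of_nonneg (by positivity)]
      gcongr
    have h4 : Real.exp (-κ * k) ≤ Real.exp (-κ * x) := Real.exp_le_exp.2 (by nlinarith)
    rw [e, abs_of_nonneg (mul_nonneg (Real.exp_pos _).le (by linarith)),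
      mul_comm (_ + _) (Real.exp _)]
    refine mul_le_mul h4 ?_ (by linarith) he.le
    nlinarith
  · rw [(hasDerivAt_resolventKernel_of_gt hx h).deriv]
    have e : -(Real.sinh (κ * k) * ((κ * x + 1) * Real.exp (-κ * x)) / x ^ 2) * x =
        -(Real.sinh (κ * k) * (κ + 1 / x) * Real.exp (-κ * x)) := by
      field_simp
    have h1 : 1 / x ≤ 1 := by
      rw [div_le_one hx]
      linarith
    rw [e, abs_neg, abs_of_nonneg (by positivity)]
    gcongr
    nlinarith

theorem integrableOn_exp_sq (hκ : 0 < κ) (C : ℝ) :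
    IntegrableOn (fun x => (C * Real.exp (-κ * x)) ^ 2) (Ioi 0) := by
  refine ((exp_neg_integrableOn_Ioi 0 (show 0 < 2 * κ by positivity)).const_mul (C ^ 2)).congr
    (Eventually.of_forall fun x => ?_)
  simp only [mul_pow]
  rw [← Real.exp_nat_mul]
  congr 2
  push_cast
  ring

theorem besselDomain_resolventKernel (hκ : 0 < κ) (hk : 1 ≤ k) :
    BesselDomain (resolventKernel κ k) where
  ac s t hs hst := by
    have h1 : LocallyLipschitz fun x => Real.sinh (κ * min x k) :=
      (ContDiff.locallyLipschitz (𝕂 := ℝ) (f := fun y => Real.sinh (κ * y))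
        (by fun_prop)).comp (LocallyLipschitz.id.min_const k)
    have h2 : LocallyLipschitz fun x => Real.exp (-κ * max x k) :=
      (ContDiff.locallyLipschitz (𝕂 := ℝ) (f := fun y => Real.exp (-κ * y))
        (by fun_prop)).comp (LocallyLipschitz.id.max_const k)
    obtain ⟨K₁, hK₁⟩ := (h1.locallyLipschitzOn (s := uIcc s t)).exists_lipschitzOnWith_of_compact
      isCompact_uIcc
    obtain ⟨K₂, hK₂⟩ := (h2.locallyLipschitzOn (s := uIcc s t)).exists_lipschitzOnWith_of_compact
      isCompact_uIcc
    have h3 : ContDiffOn ℝ 1 (fun x : ℝ => x⁻¹) (uIcc s t) := by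
      refine contDiffOn_id.inv fun x hx => ?_
      rw [uIcc_of_le hst] at hx
      exact (hs.trans_le hx.1).ne'
    exact (hK₁.absolutelyContinuousOnInterval.mul hK₂.absolutelyContinuousOnInterval).mul
      h3.absolutelyContinuousOnInterval
  energy := by
    refine Integrable.mono' (integrableOn_exp_sq hκ
      (κ * Real.cosh (κ * k) + (κ + 1) * Real.sinh (κ * k)))
      (((measurable_deriv _).pow_const 2).mul (measurable_id.pow_const 2)).aestronglyMeasurable ?_
    rw [ae_restrict_iff' measurableSet_Ioi]
    filter_upwards [Measure.ae_ne volume k] with x hxk hx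
    rw [Real.norm_eq_abs, ← mul_pow, abs_pow]
    exact pow_le_pow_left₀ (abs_nonneg _)
      (abs_deriv_resolventKernel_mul_le hκ hk hx hxk) 2
  memLp := by
    have hm : AEStronglyMeasurable (resolventKernel κ k) besselMeasure :=
      ((continuous_resolventProfile κ k).measurable.mul
        measurable_inv).aestronglyMeasurable
    rw [memLp_two_iff_integrable_sq hm, integrable_besselMeasure_iff]
    have hc := (continuous_resolventProfile κ k)
    refine (Integrable.mono' (g := fun x => (Real.sinh (κ * k) * Real.exp (-κ * x)) ^ 2)
      (f := fun x => resolventProfile κ k x ^ 2) (integrableOn_exp_sq hκ _)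
      (hc.pow 2).aestronglyMeasurable ?_).const_mul 2 |>.congr ?_
    · rw [ae_restrict_iff' measurableSet_Ioi]
      refine Eventually.of_forall fun x hx => ?_
      have h0 := resolventProfile_nonneg hκ (by linarith : 0 ≤ k) (mem_Ioi.1 hx).le
      rw [Real.norm_eq_abs, abs_of_nonneg (by positivity)]
      exact pow_le_pow_left₀ h0 (resolventProfile_le hκ (by linarith)) 2
    · rw [EventuallyEq, ae_restrict_iff' measurableSet_Ioi]
      refine Eventually.of_forall fun x hx => ?_
      have : x ≠ 0 := (mem_Ioi.1 hx).ne'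
      simp only [resolventKernel]
      field_simp

theorem tendsto_setIntegral_Ioc_Ioi {f : ℝ → ℝ} {a : ℝ} (hf : IntegrableOn f (Ioi a))
    {s t : ℕ → ℝ} (hs : Tendsto s atTop (𝓝 a)) (hs' : ∀ n, a ≤ s n)
    (ht : Tendsto t atTop atTop) :
    Tendsto (fun n => ∫ x in Ioc (s n) (t n), f x) atTop (𝓝 (∫ x in Ioi a, f x)) := by
  have h := ((aecover_Ioi_of_Ioi (μ := volume) hs).inter
    (aecover_Iic ht)).integral_tendsto_of_countably_generated hf
  refine h.congr fun n => ?_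
  rw [Measure.restrict_restrict (measurableSet_Ioi.inter measurableSet_Iic)]
  congr 2
  ext x
  simp only [mem_inter_iff, mem_Ioi, mem_Iic, mem_Ioc]
  exact ⟨fun h => h.1, fun h => ⟨h, (hs' n).trans_lt h.1⟩⟩

/-- Integration by parts against a smooth flux. -/
theorem integral_Ioc_eq_of_flux {f H H' F : ℝ → ℝ} {s t : ℝ} (hst : s ≤ t)
    (hf : AbsolutelyContinuousOnInterval f s t) (hH : ContDiff ℝ 1 H)
    (hH' : ∀ x, HasDerivAt H (H' x) x)
    (hF : ∀ x ∈ Ioo s t, F x = deriv f x * H x + f x * H' x) :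
    ∫ x in Ioc s t, F x = f t * H t - f s * H s := by
  rw [← hf.integral_deriv_mul_eq_sub hH.contDiffOn.absolutelyContinuousOnInterval,
    intervalIntegral.integral_of_le hst, integral_Ioc_eq_integral_Ioo,
    integral_Ioc_eq_integral_Ioo]
  refine setIntegral_congr_fun measurableSet_Ioo fun x hx => ?_
  rw [hF x hx, (hH' x).deriv]

/-- The resolvent kernel represents evaluation at its pole. -/
theorem besselForm_resolventKernel {f : ℝ → ℝ} (hf : BesselDomain f) (hκ : 0 < κ) (hk : 1 ≤ k) :
    besselForm (κ ^ 2 / 2) f (resolventKernel κ k) = κ * (k * f k) := by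
  have hk0 : 0 < k := by linarith
  have hG := besselDomain_resolventKernel hκ hk
  set G := resolventKernel κ k with hGdef
  set F : ℝ → ℝ := fun x => deriv f x * deriv G x * x ^ 2 + κ ^ 2 / 2 * (2 * x ^ 2 * (f x * G x))
    with hF
  have hint1 := hf.integrable_deriv_mul hG
  have hint2 : IntegrableOn (fun x => 2 * x ^ 2 * (f x * G x)) (Ioi 0) :=
    integrable_besselMeasure_iff.1 (hf.integrable_mul hG)
  have hFint : IntegrableOn F (Ioi 0) := hint1.add (hint2.const_mul _)
  have hform : besselForm (κ ^ 2 / 2) f G = ∫ x in Ioi (0 : ℝ), F x := by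
    rw [besselForm, integral_besselMeasure, ← integral_const_mul,
      ← integral_add hint1 (hint2.const_mul _)]
  -- `H₁` and `H₂` are the fluxes `x² G'` to the left and right of the pole. There `(x² G')' = κ² x²
  -- G`, so the integrand `F` is the derivative of `f` times the flux.
  set H₁ : ℝ → ℝ := fun x =>
    Real.exp (-κ * k) * (κ * Real.cosh (κ * x) * x - Real.sinh (κ * x)) with hH₁
  set H₂ : ℝ → ℝ := fun x => -(Real.sinh (κ * k) * ((κ * x + 1) * Real.exp (-κ * x))) with hH₂
  have hd₁ : ∀ x, HasDerivAt H₁ (Real.exp (-κ * k) * (κ ^ 2 * x * Real.sinh (κ * x))) x := by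
    intro x
    have hl : HasDerivAt (fun y => κ * y) (κ * 1) x := (hasDerivAt_id x).const_mul κ
    refine ((((hl.cosh.const_mul κ).mul (hasDerivAt_id x)).sub hl.sinh).const_mul
      (Real.exp (-κ * k))).congr_deriv ?_
    simp only [id_eq]
    ring
  have hd₂ : ∀ x, HasDerivAt H₂ (Real.sinh (κ * k) * (κ ^ 2 * x * Real.exp (-κ * x))) x := by
    intro x
    have hl : HasDerivAt (fun y => κ * y + 1) (κ * 1) x :=
      ((hasDerivAt_id x).const_mul κ).add_const 1
    have hl' : HasDerivAt (fun y => -κ * y) (-κ * 1) x := (hasDerivAt_id x).const_mul (-κ)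
    refine (((hl.mul hl'.exp).const_mul (Real.sinh (κ * k))).neg).congr_deriv ?_
    ring
  have hleft : ∀ s, 0 < s → s ≤ k → ∫ x in Ioc s k, F x = f k * H₁ k - f s * H₁ s := by
    intro s hs hsk
    refine integral_Ioc_eq_of_flux hsk (hf.ac s k hs hsk) (by fun_prop) hd₁ fun x hx => ?_
    have hx0 : 0 < x := hs.trans hx.1
    simp only [hF, hGdef, (hasDerivAt_resolventKernel_of_lt hx0 hx.2).deriv, resolventKernel,
      resolventProfile_of_le hx.2.le, hH₁]
    field_simp
  have hright : ∀ t, k ≤ t → ∫ x in Ioc k t, F x = f t * H₂ t - f k * H₂ k := by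
    intro t hkt
    refine integral_Ioc_eq_of_flux hkt (hf.ac k t hk0 hkt) (by fun_prop) hd₂ fun x hx => ?_
    have hx0 : 0 < x := hk0.trans hx.1
    simp only [hF, hGdef, (hasDerivAt_resolventKernel_of_gt hx0 hx.1).deriv, resolventKernel,
      resolventProfile_of_ge hx.1.le, hH₂]
    field_simp
  obtain ⟨C, hC0, hC⟩ := hf.exists_abs_le
  have hs : Tendsto (fun n : ℕ => 1 / ((n : ℝ) + 1)) atTop (𝓝 0) :=
    tendsto_one_div_add_atTop_nhds_zero_nat
  have ht : Tendsto (fun n : ℕ => k + (n : ℝ)) atTop atTop :=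
    tendsto_atTop_add_const_left _ _ tendsto_natCast_atTop_atTop
  have hspos : ∀ n : ℕ, 0 < 1 / ((n : ℝ) + 1) := fun n => by positivity
  have hsle : ∀ n : ℕ, 1 / ((n : ℝ) + 1) ≤ 1 := fun n => by
    rw [div_le_one (by positivity)]
    linarith [(Nat.cast_nonneg n : (0 : ℝ) ≤ n)]
  have htk : ∀ n : ℕ, k ≤ k + (n : ℝ) := fun n => by
    linarith [(Nat.cast_nonneg n : (0 : ℝ) ≤ n)]
  have hb₁ : Tendsto (fun n : ℕ => f (1 / ((n : ℝ) + 1)) * H₁ (1 / ((n : ℝ) + 1))) atTop (𝓝 0) := by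
    have hz : Tendsto (fun s : ℝ => Real.exp (-κ * k) * κ * (C * s + 1) *
        (Real.cosh (κ * s) - 1)) (𝓝 0) (𝓝 0) :=
      Continuous.tendsto' (by fun_prop) _ _ (by simp)
    refine squeeze_zero_norm (fun n => ?_) (hz.comp hs)
    have hs0 := hspos n
    simp only [Function.comp_apply]
    set s := 1 / ((n : ℝ) + 1)
    -- Replacing `sinh (κ s)` by its lower bound `κ s` leaves a factor `s` in the flux, which
    -- cancels the `1 / s` growth of `f`.
    have hle : κ * s ≤ Real.sinh (κ * s) := Real.self_le_sinh_iff.2 (by positivity)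
    have hge := sinh_le_mul_cosh (show 0 ≤ κ * s by positivity)
    have hH0 : 0 ≤ H₁ s := mul_nonneg (Real.exp_pos _).le (by linarith)
    have hH1 : H₁ s ≤ Real.exp (-κ * k) * κ * (Real.cosh (κ * s) - 1) * s := by
      have := mul_le_mul_of_nonneg_left (sub_le_sub_left hle (κ * Real.cosh (κ * s) * s))
        (Real.exp_pos (-κ * k)).le
      simp only [hH₁]
      linarith
    rw [norm_mul, Real.norm_eq_abs, Real.norm_eq_abs, abs_of_nonneg hH0]
    calc |f s| * H₁ s ≤ (C + 1 / s) * (Real.exp (-κ * k) * κ * (Real.cosh (κ * s) - 1) * s) :=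
          mul_le_mul (hC s hs0) hH1 hH0 (by positivity)
      _ = _ := by
          field_simp
  have hb₂ : Tendsto (fun n : ℕ => f (k + (n : ℝ)) * H₂ (k + (n : ℝ))) atTop (𝓝 0) := by
    have hlin : Tendsto (fun t : ℝ => κ * t) atTop atTop := tendsto_id.const_mul_atTop hκ
    have hz : Tendsto (fun t : ℝ => (C + 1) * (Real.sinh (κ * k) *
        ((κ * t) ^ 1 * Real.exp (-(κ * t)) + (κ * t) ^ 0 * Real.exp (-(κ * t))))) atTop (𝓝 0) := by
      simpa using ((((Real.tendsto_pow_mul_exp_neg_atTop_nhds_zero 1).comp hlin).add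
        ((Real.tendsto_pow_mul_exp_neg_atTop_nhds_zero 0).comp hlin)).const_mul
          (Real.sinh (κ * k))).const_mul (C + 1)
    refine squeeze_zero_norm (fun n => ?_) (hz.comp ht)
    have hk' := htk n
    simp only [Function.comp_apply]
    set t := k + (n : ℝ)
    have ht0 : 0 < t := by linarith
    have hft : |f t| ≤ C + 1 := by
      refine (hC t ht0).trans ?_
      have : 1 / t ≤ 1 := by
        rw [div_le_one ht0]
        linarith
      linarith
    have hsn : 0 ≤ Real.sinh (κ * k) := Real.sinh_nonneg_iff.2 (by positivity)
    have hH : |H₂ t| = Real.sinh (κ * k) * ((κ * t) ^ 1 * Real.exp (-(κ * t)) +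
        (κ * t) ^ 0 * Real.exp (-(κ * t))) := by
      simp only [hH₂, abs_neg]
      rw [abs_of_nonneg (by positivity), neg_mul]
      ring
    rw [norm_mul, Real.norm_eq_abs, Real.norm_eq_abs, hH]
    exact mul_le_mul_of_nonneg_right hft (by positivity)
  have hlim := tendsto_setIntegral_Ioc_Ioi hFint hs (fun n => (hspos n).le) ht
  -- The integral is split at the pole; in the limit only the jump of the flux there survives.
  have hlim' : Tendsto (fun n : ℕ => ∫ x in Ioc (1 / ((n : ℝ) + 1)) (k + (n : ℝ)), F x) atTop
      (𝓝 (f k * H₁ k - f k * H₂ k)) := by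
    have : Tendsto (fun n : ℕ => (f k * H₁ k - f (1 / ((n : ℝ) + 1)) * H₁ (1 / ((n : ℝ) + 1))) +
        (f (k + (n : ℝ)) * H₂ (k + (n : ℝ)) - f k * H₂ k)) atTop
        (𝓝 ((f k * H₁ k - 0) + (0 - f k * H₂ k))) :=
      (tendsto_const_nhds.sub hb₁).add (hb₂.sub tendsto_const_nhds)
    convert this using 2 with n
    · have hsk : 1 / ((n : ℝ) + 1) ≤ k := (hsle n).trans hk
      rw [← hleft _ (hspos n) hsk, ← hright _ (htk n), ← setIntegral_union
        (Ioc_disjoint_Ioc_of_le le_rfl) measurableSet_Ioc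
        (hFint.mono_set fun x hx => (hspos n).trans hx.1)
        (hFint.mono_set fun x hx => hk0.trans hx.1), Ioc_union_Ioc_eq_Ioc hsk (htk n)]
    · ring
  rw [hform, tendsto_nhds_unique hlim hlim']
  -- The jump `H₁ k - H₂ k` equals `κ k exp(-κ k) (cosh (κ k) + sinh (κ k)) = κ k`.
  have he : Real.exp (-κ * k) = Real.cosh (κ * k) - Real.sinh (κ * k) := by
    rw [Real.cosh_sub_sinh, neg_mul]
  have hcs := Real.cosh_sq (κ * k)
  simp only [hH₁, hH₂, he]
  linear_combination κ * k * f k * hcs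

end ResolventKernel

/-! ### Interpolation at the integers by resolvent kernels -/

/-- As a function of the pole, the profile is a combination of `exp(± κ k)` on either side of `j`,
and both exponentials are annihilated by the three-term operator. Only the kink at `j` contributes.
-/
theorem resolventProfile_recurrence (κ : ℝ) (j k : ℕ) :
    2 * Real.cosh κ * resolventProfile κ (k + 1 : ℕ) j - resolventProfile κ k j -
      resolventProfile κ (k + 2 : ℕ) j = if j = k + 1 then Real.sinh κ else 0 := by
  have hexp : ∀ m : ℕ, Real.exp (-κ * m) = Real.cosh (κ * m) - Real.sinh (κ * m) := fun m => by
    rw [Real.cosh_sub_sinh, neg_mul]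
  have hadd1 : κ * ((k + 1 : ℕ) : ℝ) = κ * k + κ := by push_cast; ring
  have hadd2 : κ * ((k + 2 : ℕ) : ℝ) = κ * k + κ + κ := by push_cast; ring
  have hcs := Real.cosh_sq κ
  have hcs' := Real.cosh_sq (κ * k)
  rcases lt_trichotomy j (k + 1) with h | h | h
  · rw [if_neg h.ne, resolventProfile_of_le (by exact_mod_cast h.le),
      resolventProfile_of_le (by exact_mod_cast (by omega : j ≤ k)),
      resolventProfile_of_le (by exact_mod_cast (by omega : j ≤ k + 2))]
    simp only [hexp, hadd1, hadd2, Real.cosh_add, Real.sinh_add]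
    linear_combination Real.sinh (κ * j) * (Real.cosh (κ * k) - Real.sinh (κ * k)) * hcs
  · subst h
    rw [if_pos rfl, resolventProfile_of_le le_rfl,
      resolventProfile_of_ge (by exact_mod_cast (by omega : k ≤ k + 1)),
      resolventProfile_of_le (by exact_mod_cast (by omega : k + 1 ≤ k + 2))]
    simp only [hexp, hadd1, hadd2, Real.cosh_add, Real.sinh_add]
    linear_combination (Real.sinh κ * Real.cosh κ ^ 2 - Real.sinh κ ^ 3) * hcs' + Real.sinh κ * hcs +
      Real.sinh (κ * k) * (Real.cosh (κ * k) - Real.sinh (κ * k)) *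
        (Real.cosh κ - Real.sinh κ) * hcs
  · rw [if_neg h.ne', resolventProfile_of_ge (by exact_mod_cast h.le),
      resolventProfile_of_ge (by exact_mod_cast (by omega : k ≤ j)),
      resolventProfile_of_ge (by exact_mod_cast (by omega : k + 2 ≤ j))]
    simp only [hadd1, hadd2, Real.cosh_add, Real.sinh_add]
    linear_combination Real.exp (-κ * j) * Real.sinh (κ * k) * hcs

theorem resolventProfile_zero (κ : ℝ) (j : ℕ) : resolventProfile κ 0 j = 0 := by
  rw [resolventProfile_of_ge (Nat.cast_nonneg j)]
  simp

/-- Discrete Green identity: moving the three-term operator from `w` to the profile gives a delta at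
`j` and boundary terms at `N`. Together with `w 0 = 0`, the vanishing of the profile at pole `0`
removes the other boundary. -/
theorem sum_resolventProfile (κ : ℝ) {w : ℕ → ℝ} (hw : w 0 = 0) (N j : ℕ) :
    ∑ k ∈ Finset.range N, (2 * Real.cosh κ * w (k + 1) - w k - w (k + 2)) *
      resolventProfile κ (k + 1 : ℕ) j =
    Real.sinh κ * (if j ≤ N then w j else 0) +
      (w N * resolventProfile κ (N + 1 : ℕ) j - w (N + 1) * resolventProfile κ N j) := by
  induction N with
  | zero =>
    have h0 := resolventProfile_zero κ j
    by_cases h : j = 0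
    · subst h
      rw [Nat.cast_zero] at h0
      simp [hw, h0]
    · simp [h, hw, h0]
  | succ N ih =>
    rw [Finset.sum_range_succ, ih]
    have h := resolventProfile_recurrence κ j N
    have hif : (if j ≤ N + 1 then w j else 0) =
        (if j ≤ N then w j else 0) + if j = N + 1 then w (N + 1) else 0 := by
      rcases lt_trichotomy j (N + 1) with h | h | h
      · rw [if_pos h.le, if_pos (by omega), if_neg h.ne, add_zero]
      · subst h
        simp
      · rw [if_neg (by omega), if_neg (by omega), if_neg (by omega), add_zero]
    have hif' : (if j = N + 1 then w (N + 1) else 0) * Real.sinh κ =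
        (if j = N + 1 then Real.sinh κ else 0) * w (N + 1) := by
      split_ifs <;> ring
    rw [hif]
    linear_combination w (N + 1) * h - hif'

/-- The combination of resolvent kernels with poles at `1, …, N` that takes at `j ≤ N` the value
`w j / j`, provided that `w` has the appropriate value at `N + 1`. -/
def resolventInterpolant (κ : ℝ) (N : ℕ) (w : ℕ → ℝ) (x : ℝ) : ℝ :=
  ∑ k ∈ Finset.range N, (2 * Real.cosh κ * w (k + 1) - w k - w (k + 2)) / Real.sinh κ *
    resolventKernel κ (k + 1 : ℕ) x

/-- The energy of the interpolant. -/
def interpolantEnergy (κ : ℝ) (N : ℕ) (w : ℕ → ℝ) : ℝ :=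
  κ / Real.sinh κ * ∑ k ∈ Finset.range N,
    (2 * Real.cosh κ * w (k + 1) - w k - w (k + 2)) * w (k + 1)

theorem natCast_mul_resolventInterpolant {κ : ℝ} (hκ : 0 < κ) {w : ℕ → ℝ} (hw : w 0 = 0)
    (N j : ℕ) :
    j * resolventInterpolant κ N w j = (if j ≤ N then w j else 0) +
      (w N * resolventProfile κ (N + 1 : ℕ) j - w (N + 1) * resolventProfile κ N j) /
        Real.sinh κ := by
  have hs : Real.sinh κ ≠ 0 := (Real.sinh_pos_iff.2 hκ).ne'
  have h := sum_resolventProfile κ hw N j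
  by_cases hj : j = 0
  · subst hj
    have h0 : ∀ k : ℕ, resolventProfile κ k (0 : ℕ) = 0 := fun k => by
      rw [resolventProfile_of_le (by exact_mod_cast Nat.zero_le k)]
      simp
    rw [h0, h0]
    simp [hw]
  · have hj' : (j : ℝ) ≠ 0 := by exact_mod_cast hj
    rw [← sub_eq_iff_eq_add'] at h
    rw [← h, resolventInterpolant, Finset.mul_sum, sub_div, mul_div_cancel_left₀ _ hs,
      add_sub_cancel, Finset.sum_div]
    refine Finset.sum_congr rfl fun k _ => ?_
    rw [resolventKernel]
    field_simp

theorem besselDomain_resolventKernel_succ {κ : ℝ} (hκ : 0 < κ) (k : ℕ) :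
    BesselDomain (resolventKernel κ (k + 1 : ℕ)) :=
  besselDomain_resolventKernel hκ (by push_cast; linarith [(Nat.cast_nonneg k : (0 : ℝ) ≤ k)])

theorem besselForm_resolventKernel_succ {κ : ℝ} (hκ : 0 < κ) {f : ℝ → ℝ} (hf : BesselDomain f)
    (k : ℕ) : besselForm (κ ^ 2 / 2) f (resolventKernel κ (k + 1 : ℕ)) =
      κ * ((k + 1 : ℕ) * f (k + 1 : ℕ)) :=
  besselForm_resolventKernel hf hκ (by push_cast; linarith [(Nat.cast_nonneg k : (0 : ℝ) ≤ k)])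

theorem besselDomain_resolventInterpolant {κ : ℝ} (hκ : 0 < κ) (N : ℕ) (w : ℕ → ℝ) :
    BesselDomain (resolventInterpolant κ N w) :=
  BesselDomain.sum (Finset.range N) _ (besselDomain_resolventKernel_succ hκ)

/-- By the reproducing property the pairing sees only the values of `f` at `1, …, N`. Hence it is
the same for `f` and for the interpolant whenever their values agree. -/
theorem besselForm_resolventInterpolant {κ : ℝ} (hκ : 0 < κ) {f : ℝ → ℝ} (hf : BesselDomain f)
    (N : ℕ) (w : ℕ → ℝ) (hfw : ∀ j ≤ N, j * f j = w j) :
    besselForm (κ ^ 2 / 2) f (resolventInterpolant κ N w) = interpolantEnergy κ N w := by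
  unfold resolventInterpolant
  rw [besselForm_sum_right _ _ _ hf (besselDomain_resolventKernel_succ hκ), interpolantEnergy,
    Finset.mul_sum]
  refine Finset.sum_congr rfl fun k hk => ?_
  rw [besselForm_resolventKernel_succ hκ hf, hfw (k + 1) (Finset.mem_range.1 hk)]
  ring

/-- Energies are bounded below by those of interpolants. -/
theorem interpolantEnergy_le_besselForm {κ : ℝ} (hκ : 0 < κ) {f : ℝ → ℝ} (hf : BesselDomain f)
    (N : ℕ) :
    interpolantEnergy κ N (fun j => if j ≤ N then j * f j else Real.exp (-κ) * (N * f N)) ≤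
      besselForm (κ ^ 2 / 2) f f := by
  set w : ℕ → ℝ := fun j => if j ≤ N then j * f j else Real.exp (-κ) * (N * f N) with hw
  have hw0 : w 0 = 0 := by simp [hw]
  have hwj : ∀ j ≤ N, w j = j * f j := fun j hj => if_pos hj
  -- This value at `N + 1` cancels the boundary terms in the Green identity: for `j ≤ N` the profile
  -- at pole `N + 1` is `exp(-κ)` times that at pole `N`. It is the decaying continuation of the
  -- data.
  have hwN : w (N + 1) = Real.exp (-κ) * (N * f N) := if_neg (by omega)
  have hg := besselDomain_resolventInterpolant hκ N w
  have hval : ∀ j ≤ N, j * resolventInterpolant κ N w j = w j := by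
    intro j hj
    rw [natCast_mul_resolventInterpolant hκ hw0, if_pos hj, hwj N le_rfl, hwN,
      resolventProfile_of_le (by exact_mod_cast (by omega : j ≤ N + 1)),
      resolventProfile_of_le (by exact_mod_cast hj)]
    have : Real.exp (-κ * (N + 1 : ℕ)) = Real.exp (-κ * N) * Real.exp (-κ) := by
      rw [← Real.exp_add]
      push_cast
      ring_nf
    rw [this]
    ring
  -- With the interpolant `g`, both `ℰ(f, g)` and `ℰ(g, g)` equal the interpolant energy, so `2 ℰ(f,
  -- g) - ℰ(g, g)` does too.
  have h := two_mul_besselForm_sub_le (by positivity : 0 ≤ κ ^ 2 / 2) hf hg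
  rw [besselForm_resolventInterpolant hκ hf N w fun j hj => (hwj j hj).symm,
    besselForm_resolventInterpolant hκ hg N w hval] at h
  linarith

theorem resolventInterpolant_of_support {κ : ℝ} (hκ : 0 < κ) {w : ℕ → ℝ} (hw : w 0 = 0) {N : ℕ}
    (hN : ∀ j, N ≤ j → w j = 0) (j : ℕ) : j * resolventInterpolant κ N w j = w j := by
  rw [natCast_mul_resolventInterpolant hκ hw, hN N le_rfl, hN (N + 1) (by omega)]
  by_cases hj : j ≤ N
  · simp [hj]
  · simp [hj, hN j (by omega)]

/-! ### The kernel of `J` and the projection -/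

theorem kerJOrth_resolventKernel {κ : ℝ} (hκ : 0 < κ) (k : ℕ) :
    KerJOrth (κ ^ 2 / 2) (resolventKernel κ (k + 1 : ℕ)) := by
  refine ⟨besselDomain_resolventKernel_succ hκ k, fun w hw => ?_⟩
  have : w (k + 1 : ℕ) = 0 := hw.2 k.succPNat
  rw [besselForm_comm, besselForm_resolventKernel_succ hκ hw.1, this]
  ring

theorem kerJOrth_resolventInterpolant {κ : ℝ} (hκ : 0 < κ) (N : ℕ) (w : ℕ → ℝ) :
    KerJOrth (κ ^ 2 / 2) (resolventInterpolant κ N w) := by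
  refine ⟨besselDomain_resolventInterpolant hκ N w, fun u hu => ?_⟩
  unfold resolventInterpolant
  rw [besselForm_comm, besselForm_sum_right _ _ _ hu.1 (besselDomain_resolventKernel_succ hκ)]
  refine Finset.sum_eq_zero fun k _ => ?_
  rw [besselForm_comm, (kerJOrth_resolventKernel hκ k).2 u hu, mul_zero]

/-- The defect `u - v` is orthogonal to every resolvent kernel with integer pole, and by the
reproducing property this says that it vanishes at every positive integer. -/
theorem IsProjection.restrictNat_eq {κ : ℝ} (hκ : 0 < κ) {u v : ℝ → ℝ} (hu : BesselDomain u)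
    (h : IsProjection (κ ^ 2 / 2) u v) : restrictNat v = restrictNat u := by
  funext k
  obtain ⟨n, rfl⟩ : ∃ n : ℕ, k = n.succPNat := ⟨k.natPred, (PNat.succPNat_natPred k).symm⟩
  have h1 := h.2 _ (kerJOrth_resolventKernel hκ n)
  rw [besselForm_resolventKernel_succ hκ (hu.sub h.1.1)] at h1
  have hn : ((n + 1 : ℕ) : ℝ) ≠ 0 := by positivity
  have h2 := (mul_eq_zero.1 ((mul_eq_zero.1 h1).resolve_left hκ.ne')).resolve_left hn
  exact (sub_eq_zero.1 h2).symm

theorem KerJOrth.isProjection_self {l : ℝ} {v : ℝ → ℝ} (h : KerJOrth l v) :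
    IsProjection l v v := ⟨h, fun w _ => by simp [besselForm]⟩

/-! ### The limit of vanishing parameter -/

theorem sum_second_difference_mul {w : ℕ → ℝ} (hw : w 0 = 0) (N : ℕ) :
    ∑ k ∈ Finset.range N, (2 * w (k + 1) - w k - w (k + 2)) * w (k + 1) =
      ∑ k ∈ Finset.range N, (w (k + 1) - w k) ^ 2 + w N * (w N - w (N + 1)) := by
  induction N with
  | zero => simp [hw]
  | succ N ih =>
    rw [Finset.sum_range_succ, Finset.sum_range_succ, ih]
    ring

theorem tendsto_div_sinh : Tendsto (fun κ : ℝ => κ / Real.sinh κ) (𝓝[≠] 0) (𝓝 1) := by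
  have h := (hasDerivAt_iff_tendsto_slope_zero.1 (Real.hasDerivAt_sinh 0)).inv₀ (by simp)
  simpa [div_eq_inv_mul] using h

/-- As the parameter tends to zero, the energy of the interpolant tends to the discrete energy. -/
theorem tendsto_interpolantEnergy {κ : ℕ → ℝ} (hκ : ∀ n, 0 < κ n) (hκ0 : Tendsto κ atTop (𝓝 0))
    {w : ℕ → ℕ → ℝ} {w₀ : ℕ → ℝ} (hw₀ : w₀ 0 = 0) {N : ℕ}
    (hw : ∀ j ≤ N + 1, Tendsto (fun n => w n j) atTop (𝓝 (w₀ j))) :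
    Tendsto (fun n => interpolantEnergy (κ n) N (w n)) atTop
      (𝓝 (∑ k ∈ Finset.range N, (w₀ (k + 1) - w₀ k) ^ 2 + w₀ N * (w₀ N - w₀ (N + 1)))) := by
  rw [← sum_second_difference_mul hw₀, ← one_mul (∑ k ∈ Finset.range N, _)]
  refine (tendsto_div_sinh.comp (tendsto_nhdsWithin_iff.2
    ⟨hκ0, Eventually.of_forall fun n => (hκ n).ne'⟩)).mul (tendsto_finsetSum _ fun k hk => ?_)
  have hk := Finset.mem_range.1 hk
  have hc : Tendsto (fun n => Real.cosh (κ n)) atTop (𝓝 1) := by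
    simpa [Function.comp_def] using (Real.continuous_cosh.tendsto 0).comp hκ0
  simpa using ((((hc.const_mul 2).mul (hw (k + 1) (by omega))).sub (hw k (by omega))).sub
    (hw (k + 2) (by omega))).mul (hw (k + 1) (by omega))

/-! ### Coordinates on `ℓ²(μ)` -/

theorem discreteMeasure_singleton (a : ℕ+ → ℝ) (k : ℕ+) :
    discreteMeasure a {k} = ENNReal.ofReal (a k) := by
  rw [discreteMeasure, Measure.sum_apply _ (measurableSet_singleton k), tsum_eq_single k]
  · simp
  · intro j hj
    simp [hj]

theorem lintegral_discreteMeasure (a : ℕ+ → ℝ) (f : ℕ+ → ℝ≥0∞) :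
    ∫⁻ k, f k ∂discreteMeasure a = ∑' k, ENNReal.ofReal (a k) * f k := by
  simp [discreteMeasure, lintegral_sum_measure]

/-- Every point has positive mass, so only the empty set is null. Elements of `ℓ²(μ)` can therefore
be handled as functions, pointwise. -/
theorem forall_of_ae_discreteMeasure {a : ℕ+ → ℝ} (ha : ∀ k, 0 < a k) {p : ℕ+ → Prop}
    (h : ∀ᵐ k ∂discreteMeasure a, p k) (k : ℕ+) : p k := by
  by_contra hk
  have h1 : discreteMeasure a {k} ≤ 0 :=
    (measure_mono (by simpa using hk)).trans_eq (ae_iff.1 h)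
  rw [discreteMeasure_singleton] at h1
  simp [(ha k).not_ge] at h1

theorem Lp_add_apply {a : ℕ+ → ℝ} (ha : ∀ k, 0 < a k) (u v : Lp ℝ 2 (discreteMeasure a)) (k : ℕ+) : (u + v) k = u k + v k :=
  forall_of_ae_discreteMeasure ha (Lp.coeFn_add u v) k

theorem Lp_sub_apply {a : ℕ+ → ℝ} (ha : ∀ k, 0 < a k) (u v : Lp ℝ 2 (discreteMeasure a)) (k : ℕ+) : (u - v) k = u k - v k :=
  forall_of_ae_discreteMeasure ha (Lp.coeFn_sub u v) k

theorem Lp_smul_apply {a : ℕ+ → ℝ} (ha : ∀ k, 0 < a k) (c : ℝ) (u : Lp ℝ 2 (discreteMeasure a)) (k : ℕ+) : (c • u) k = c * u k :=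
  forall_of_ae_discreteMeasure ha (Lp.coeFn_smul c u) k

theorem toLp_apply {a : ℕ+ → ℝ} (ha : ∀ k, 0 < a k) {f : ℕ+ → ℝ} (hf : MemLp f 2 (discreteMeasure a)) (k : ℕ+) :
    hf.toLp f k = f k :=
  forall_of_ae_discreteMeasure ha hf.coeFn_toLp k

theorem cutoff_apply {a : ℕ+ → ℝ} (ha : ∀ k, 0 < a k) (A : Set ℕ+) (hA : MeasurableSet A) (u : Lp ℝ 2 (discreteMeasure a))
    (k : ℕ+) : cutoff A hA u k = A.indicator u k :=
  toLp_apply ha _ k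

/-- The indicator function of `{k}`. -/
def unitVector (a : ℕ+ → ℝ) (k : ℕ+) : Lp ℝ 2 (discreteMeasure a) :=
  indicatorConstLp 2 (measurableSet_singleton k)
    (by rw [discreteMeasure_singleton]; exact ENNReal.ofReal_ne_top) 1

theorem unitVector_apply {a : ℕ+ → ℝ} (ha : ∀ k, 0 < a k) (k j : ℕ+) :
    unitVector a k j = if j = k then 1 else 0 := by
  rw [unitVector, forall_of_ae_discreteMeasure ha indicatorConstLp_coeFn j]
  simp [indicator_apply]

theorem inner_unitVector {a : ℕ+ → ℝ} (ha : ∀ k, 0 < a k) (k : ℕ+)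
    (u : Lp ℝ 2 (discreteMeasure a)) : inner ℝ u (unitVector a k) = a k * u k := by
  rw [real_inner_comm, unitVector, L2.inner_indicatorConstLp_one, integral_singleton,
    measureReal_def, discreteMeasure_singleton, ENNReal.toReal_ofReal (ha k).le, smul_eq_mul]

/-- Pairing with the indicator of `{k}` gives `a k` times the value at `k`. Coordinatewise
convergence is all that the liminf inequality extracts from weak convergence. -/
theorem tendsto_apply_of_tendsto_inner {a : ℕ+ → ℝ} (ha : ∀ k, 0 < a k) {ι : Type*}
    {F : Filter ι} {φ : ι → Lp ℝ 2 (discreteMeasure a)} {φ₀ : Lp ℝ 2 (discreteMeasure a)}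
    (h : ∀ ψ : Lp ℝ 2 (discreteMeasure a),
      Tendsto (fun n => inner ℝ (φ n) ψ) F (𝓝 (inner ℝ φ₀ ψ))) (k : ℕ+) :
    Tendsto (fun n => φ n k) F (𝓝 (φ₀ k)) := by
  have h1 := (h (unitVector a k)).const_mul (a k)⁻¹
  simpa only [inner_unitVector ha, inv_mul_cancel_left₀ (ha k).ne'] using h1

theorem continuous_Lp_apply {a : ℕ+ → ℝ} (ha : ∀ k, 0 < a k) (k : ℕ+) :
    Continuous fun u : Lp ℝ 2 (discreteMeasure a) => u k :=
  continuous_iff_continuousAt.2 fun u => tendsto_apply_of_tendsto_inner ha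
    (fun _ => ((continuous_id.inner continuous_const).tendsto u)) k

/-- Dominated convergence in `ℓ²(μ)`. -/
theorem tendsto_Lp_of_dominated {a : ℕ+ → ℝ} (ha : ∀ k, 0 < a k)
    {φ : ℕ → Lp ℝ 2 (discreteMeasure a)} {φ₀ : Lp ℝ 2 (discreteMeasure a)}
    (hle : ∀ n k, |φ n k| ≤ |φ₀ k|) (h : ∀ k, Tendsto (fun n => φ n k) atTop (𝓝 (φ₀ k))) :
    Tendsto φ atTop (𝓝 φ₀) := by
  rw [tendsto_iff_norm_sub_tendsto_zero]
  have hsq : Tendsto (fun n => ‖φ n - φ₀‖ ^ 2) atTop (𝓝 0) := by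
    have hn : ∀ n, ‖φ n - φ₀‖ ^ 2 = ∫ k, (φ n k - φ₀ k) ^ 2 ∂discreteMeasure a := fun n => by
      rw [← real_inner_self_eq_norm_sq, L2.inner_def]
      refine integral_congr_ae (Eventually.of_forall fun k => ?_)
      simp only [Lp_sub_apply ha, real_inner_self_eq_norm_sq, Real.norm_eq_abs, sq_abs]
    simp only [hn]
    have h0 : ∫ _k, (0 : ℝ) ∂discreteMeasure a = 0 := integral_zero _ _
    rw [← h0]
    refine tendsto_integral_of_dominated_convergence (fun k => 4 * φ₀ k ^ 2)
      (fun n => (measurable_of_countable _).aestronglyMeasurable)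
      ((Lp.memLp φ₀).integrable_sq.const_mul 4) (fun n => Eventually.of_forall fun k => ?_)
      (Eventually.of_forall fun k => ?_)
    · have h1 : |φ n k - φ₀ k| ≤ 2 * |φ₀ k| := (abs_sub _ _).trans (by linarith [hle n k])
      rw [Real.norm_eq_abs, abs_pow]
      calc |φ n k - φ₀ k| ^ 2 ≤ (2 * |φ₀ k|) ^ 2 := pow_le_pow_left₀ (abs_nonneg _) h1 2
        _ = 4 * φ₀ k ^ 2 := by rw [mul_pow, sq_abs]; norm_num
    · simpa using ((h k).sub_const (φ₀ k)).pow 2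
  simpa using hsq.sqrt

/-! ### The discrete energy -/

/-- The sequence `k ↦ k φ(k)`, extended by zero to `k = 0`. -/
def weightedSeq (φ : ℕ+ → ℝ) : ℕ → ℝ
  | 0 => 0
  | k + 1 => ((k + 1 : ℕ) : ℝ) * φ k.succPNat

/-- The energy `∑ ((k + 1) φ(k + 1) - k φ(k))²`. -/
def discreteEnergy (φ : ℕ+ → ℝ) : ℝ≥0∞ :=
  ∑' k : ℕ, ENNReal.ofReal ((weightedSeq φ (k + 1) - weightedSeq φ k) ^ 2)

/-- The sum of the first `N` terms of the energy. -/
def partialEnergy (φ : ℕ+ → ℝ) (N : ℕ) : ℝ :=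
  ∑ k ∈ Finset.range N, (weightedSeq φ (k + 1) - weightedSeq φ k) ^ 2

theorem weightedSeq_succ (φ : ℕ+ → ℝ) (k : ℕ) :
    weightedSeq φ (k + 1) = ((k + 1 : ℕ) : ℝ) * φ k.succPNat := rfl

theorem discreteEnergy_eq_iSup (φ : ℕ+ → ℝ) :
    discreteEnergy φ = ⨆ N, ENNReal.ofReal (partialEnergy φ N) := by
  rw [discreteEnergy, ENNReal.tsum_eq_iSup_nat]
  simp only [partialEnergy, ENNReal.ofReal_sum_of_nonneg fun _ _ => sq_nonneg _]

theorem ofReal_partialEnergy_le (φ : ℕ+ → ℝ) (N : ℕ) :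
    ENNReal.ofReal (partialEnergy φ N) ≤ discreteEnergy φ := by
  rw [discreteEnergy_eq_iSup]
  exact le_iSup (fun N => ENNReal.ofReal (partialEnergy φ N)) N

/-- From `((k+2) b - (k+1) a)² = (k+1)(k+2)(b - a)² + (k+2) b² - (k+1) a²`, whose last two terms
telescope. All coefficients are nonnegative, so contractions visibly lower the energy, and the last
term bounds `φ` pointwise. -/
theorem partialEnergy_succ_eq (φ : ℕ+ → ℝ) (N : ℕ) :
    partialEnergy φ (N + 1) =
      ∑ k ∈ Finset.range N, ((k : ℝ) + 1) * (k + 2) *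
        (φ (k + 1).succPNat - φ k.succPNat) ^ 2 + (N + 1) * φ N.succPNat ^ 2 := by
  induction N with
  | zero => simp [partialEnergy, weightedSeq]
  | succ N ih =>
    rw [partialEnergy, Finset.sum_range_succ, ← partialEnergy, ih, Finset.sum_range_succ,
      weightedSeq_succ, weightedSeq_succ]
    push_cast
    ring

theorem sq_le_partialEnergy (φ : ℕ+ → ℝ) (N : ℕ) :
    (N + 1) * φ N.succPNat ^ 2 ≤ partialEnergy φ (N + 1) := by
  rw [partialEnergy_succ_eq]
  have : 0 ≤ ∑ k ∈ Finset.range N, ((k : ℝ) + 1) * (k + 2) *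
      (φ (k + 1).succPNat - φ k.succPNat) ^ 2 := Finset.sum_nonneg fun k _ => by positivity
  linarith

/-- Normal contractions operate on the discrete energy. -/
theorem discreteEnergy_le_of_contraction {φ ψ : ℕ+ → ℝ} (h : ∀ k, |ψ k| ≤ |φ k|)
    (h' : ∀ j k, |ψ j - ψ k| ≤ |φ j - φ k|) : discreteEnergy ψ ≤ discreteEnergy φ := by
  rw [discreteEnergy_eq_iSup ψ]
  refine iSup_le fun N => ?_
  refine le_trans (ENNReal.ofReal_le_ofReal ?_) (ofReal_partialEnergy_le φ N)
  cases N with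
  | zero => simp [partialEnergy]
  | succ N =>
    rw [partialEnergy_succ_eq, partialEnergy_succ_eq]
    refine add_le_add (Finset.sum_le_sum fun k _ => ?_) ?_
    · exact mul_le_mul_of_nonneg_left (sq_le_sq.2 (h' _ _)) (by positivity)
    · exact mul_le_mul_of_nonneg_left (sq_le_sq.2 (h _)) (by positivity)

theorem partialEnergy_le_toReal {φ : ℕ+ → ℝ} (h : discreteEnergy φ < ∞) (N : ℕ) :
    partialEnergy φ N ≤ (discreteEnergy φ).toReal :=
  (ENNReal.ofReal_le_iff_le_toReal h.ne).1 (ofReal_partialEnergy_le φ N)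

theorem discreteEnergy_lt_top_of_support {φ : ℕ+ → ℝ} {N : ℕ}
    (h : ∀ k : ℕ, N ≤ k → φ k.succPNat = 0) : discreteEnergy φ < ∞ := by
  rw [discreteEnergy, tsum_eq_sum (s := Finset.range (N + 1))]
  · exact ENNReal.sum_lt_top.2 fun _ _ => ENNReal.ofReal_lt_top
  · intro k hk
    obtain ⟨m, rfl⟩ : ∃ m, k = m + 1 :=
      Nat.exists_eq_succ_of_ne_zero (by rintro rfl; simp at hk)
    have : N ≤ m := by simp at hk; omega
    rw [weightedSeq_succ, weightedSeq_succ, h m this, h (m + 1) (by omega)]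
    simp

/-! ### The limit form -/

theorem weightedSeq_add (φ ψ : ℕ+ → ℝ) (k : ℕ) :
    weightedSeq (fun j => φ j + ψ j) k = weightedSeq φ k + weightedSeq ψ k := by
  cases k <;> simp [weightedSeq, mul_add]

theorem weightedSeq_const_mul (c : ℝ) (φ : ℕ+ → ℝ) (k : ℕ) :
    weightedSeq (fun j => c * φ j) k = c * weightedSeq φ k := by
  cases k <;> simp [weightedSeq, mul_left_comm]

theorem discreteEnergy_const_mul (c : ℝ) (φ : ℕ+ → ℝ) :
    discreteEnergy (fun j => c * φ j) = ENNReal.ofReal (c ^ 2) * discreteEnergy φ := by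
  simp only [discreteEnergy, weightedSeq_const_mul, ← mul_sub, mul_pow,
    ENNReal.ofReal_mul (sq_nonneg c), ENNReal.tsum_mul_left]

theorem discreteEnergy_parallelogram (φ ψ : ℕ+ → ℝ) :
    discreteEnergy (fun j => φ j + ψ j) + discreteEnergy (fun j => φ j - ψ j) =
      2 * discreteEnergy φ + 2 * discreteEnergy ψ := by
  have hsub : ∀ k, weightedSeq (fun j => φ j - ψ j) k = weightedSeq φ k - weightedSeq ψ k := by
    intro k
    have h := weightedSeq_add (fun j => φ j - ψ j) ψ k
    simp only [sub_add_cancel] at h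
    linarith
  simp only [discreteEnergy, weightedSeq_add, hsub, ← ENNReal.tsum_mul_left, ← ENNReal.tsum_add]
  refine tsum_congr fun k => ?_
  rw [← ENNReal.ofReal_ofNat 2, ← ENNReal.ofReal_mul zero_le_two, ← ENNReal.ofReal_mul zero_le_two,
    ← ENNReal.ofReal_add (by positivity) (by positivity),
    ← ENNReal.ofReal_add (by positivity) (by positivity)]
  congr 1
  ring

theorem exists_truncations {a : ℕ+ → ℝ} (ha : ∀ k, 0 < a k) (φ : Lp ℝ 2 (discreteMeasure a)) :
    ∃ ψ : ℕ → Lp ℝ 2 (discreteMeasure a), Tendsto ψ atTop (𝓝 φ) ∧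
      ∀ n, discreteEnergy (ψ n) < ∞ := by
  refine ⟨fun n => cutoff {k : ℕ+ | (k : ℕ) ≤ n} (MeasurableSet.of_discrete) φ,
    tendsto_Lp_of_dominated ha (fun n k => ?_) fun k => ?_,
    fun n => discreteEnergy_lt_top_of_support (N := n) fun k hk => ?_⟩
  · rw [cutoff_apply ha, indicator_apply]
    split_ifs <;> simp
  · refine tendsto_const_nhds.congr' ?_
    filter_upwards [eventually_ge_atTop (k : ℕ)] with n hn
    rw [cutoff_apply ha, indicator_of_mem]
    exact hn
  · rw [cutoff_apply ha, indicator_of_notMem]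
    simp only [mem_ofPred_eq, Nat.succPNat_coe, not_le]
    omega

theorem isDirichletForm_discreteEnergy {a : ℕ+ → ℝ} (ha : ∀ k, 0 < a k) :
    IsDirichletForm fun φ : Lp ℝ 2 (discreteMeasure a) => discreteEnergy φ where
  smul c u := by
    rw [← discreteEnergy_const_mul]
    exact congrArg discreteEnergy (funext (Lp_smul_apply ha c u))
  parallelogram u v := by
    rw [← discreteEnergy_parallelogram, ← funext (Lp_add_apply ha u v),
      ← funext (Lp_sub_apply ha u v)]
  dense φ := by
    obtain ⟨ψ, hψ, h⟩ := exists_truncations ha φ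
    exact mem_closure_of_tendsto hψ (Eventually.of_forall h)
  closed := by
    -- The energy is a sum of nonnegative functions continuous on `ℓ²(μ)`, hence lower
    -- semicontinuous.
    have hw : ∀ k, Continuous fun φ : Lp ℝ 2 (discreteMeasure a) => weightedSeq φ k := by
      rintro (_ | k)
      · exact continuous_const
      · exact continuous_const.mul (continuous_Lp_apply ha _)
    exact lowerSemicontinuous_tsum fun k => (ENNReal.continuous_ofReal.comp
      (((hw (k + 1)).sub (hw k)).pow 2)).lowerSemicontinuous
  markov u v h := by
    have hv := forall_of_ae_discreteMeasure ha h
    refine discreteEnergy_le_of_contraction (fun k => ?_) fun j k => ?_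
    · rw [hv]
      grind
    · rw [hv, hv]
      grind

/-! ### Irreducibility -/

/-- An invariant set contains with an integer also its successor, and conversely. -/
theorem IsInvariantSet.succ_mem_iff {a : ℕ+ → ℝ} (ha : ∀ k, 0 < a k) {A : Set ℕ+}
    {hA : MeasurableSet A}
    (h : IsInvariantSet (fun φ : Lp ℝ 2 (discreteMeasure a) => discreteEnergy φ) A hA) (n : ℕ) :
    n.succPNat ∈ A ↔ (n + 1).succPNat ∈ A := by
  by_contra hne
  -- The test function is the indicator of two neighbours separated by `A`. Its two pieces `α`, `β`
  -- are nonnegative with disjoint supports, and their interaction makes the energy of the sum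
  -- strictly smaller than the sum of the energies.
  set u : Lp ℝ 2 (discreteMeasure a) :=
    unitVector a n.succPNat + unitVector a (n + 1).succPNat with hu
  have hnn : n.succPNat ≠ (n + 1).succPNat := by
    intro h
    have := congrArg PNat.val h
    simp at this
  have hun : u n.succPNat = 1 := by
    rw [hu, Lp_add_apply ha, unitVector_apply ha, unitVector_apply ha, if_pos rfl, if_neg hnn,
      add_zero]
  have hun' : u (n + 1).succPNat = 1 := by
    rw [hu, Lp_add_apply ha, unitVector_apply ha, unitVector_apply ha, if_pos rfl, if_neg hnn.symm,
      zero_add]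
  have hu0 : ∀ k, 0 ≤ u k := fun k => by
    rw [hu, Lp_add_apply ha, unitVector_apply ha, unitVector_apply ha]
    split_ifs <;> norm_num
  have hufin : discreteEnergy u < ∞ := by
    refine discreteEnergy_lt_top_of_support (N := n + 2) fun k hk => ?_
    have h1 : k.succPNat ≠ n.succPNat := fun h => by
      have := congrArg PNat.val h
      simp at this
      omega
    have h2 : k.succPNat ≠ (n + 1).succPNat := fun h => by
      have := congrArg PNat.val h
      simp at this
      omega
    rw [hu, Lp_add_apply ha, unitVector_apply ha, unitVector_apply ha, if_neg h1, if_neg h2,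
      add_zero]
  obtain ⟨-, -, heq⟩ := h u hufin
  set α : ℕ+ → ℝ := A.indicator u
  set β : ℕ+ → ℝ := Aᶜ.indicator u
  have hαu : discreteEnergy (cutoff A hA u) = discreteEnergy α :=
    congrArg discreteEnergy (funext (cutoff_apply ha A hA u))
  have hβu : discreteEnergy (cutoff Aᶜ hA.compl u) = discreteEnergy β :=
    congrArg discreteEnergy (funext (cutoff_apply ha Aᶜ hA.compl u))
  have hsum : (u : ℕ+ → ℝ) = fun k => α k + β k := by
    funext k
    exact (congrFun (indicator_self_add_compl A (u : ℕ+ → ℝ)) k).symm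
  simp only [hαu, hβu] at heq
  have hα0 : ∀ k, 0 ≤ weightedSeq α k := by
    rintro (_ | k)
    · exact le_rfl
    · exact mul_nonneg (Nat.cast_nonneg _) (indicator_nonneg (fun j _ => hu0 j) _)
  have hβ0 : ∀ k, 0 ≤ weightedSeq β k := by
    rintro (_ | k)
    · exact le_rfl
    · exact mul_nonneg (Nat.cast_nonneg _) (indicator_nonneg (fun j _ => hu0 j) _)
  have hαβ : ∀ k, weightedSeq α k * weightedSeq β k = 0 := by
    rintro (_ | k)
    · exact mul_zero _
    · by_cases hk : k.succPNat ∈ A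
      · have : β k.succPNat = 0 := indicator_of_notMem (notMem_compl_iff.2 hk) _
        rw [weightedSeq_succ β, this, mul_zero, mul_zero]
      · have : α k.succPNat = 0 := indicator_of_notMem hk _
        rw [weightedSeq_succ α, this, mul_zero, zero_mul]
  have hcross : 0 < weightedSeq α (n + 1) * weightedSeq β (n + 2) +
      weightedSeq β (n + 1) * weightedSeq α (n + 2) := by
    simp only [weightedSeq_succ]
    by_cases hn : n.succPNat ∈ A
    · have hn' : (n + 1).succPNat ∉ A := fun h => hne ⟨fun _ => h, fun _ => hn⟩
      have h1 : α n.succPNat = 1 := (indicator_of_mem hn _).trans hun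
      have h2 : β (n + 1).succPNat = 1 := (indicator_of_mem hn' _).trans hun'
      have h3 : β n.succPNat = 0 := indicator_of_notMem (notMem_compl_iff.2 hn) _
      rw [h1, h2, h3]
      push_cast
      nlinarith [(Nat.cast_nonneg n : (0 : ℝ) ≤ n)]
    · have hn' : (n + 1).succPNat ∈ A := by
        by_contra h
        exact hne ⟨fun h' => absurd h' hn, fun h' => absurd h' h⟩
      have h1 : β n.succPNat = 1 := (indicator_of_mem hn _).trans hun
      have h2 : α (n + 1).succPNat = 1 := (indicator_of_mem hn' _).trans hun'
      have h3 : α n.succPNat = 0 := indicator_of_notMem hn _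
      rw [h1, h2, h3]
      push_cast
      nlinarith [(Nat.cast_nonneg n : (0 : ℝ) ≤ n)]
  have hlt : discreteEnergy u < discreteEnergy α + discreteEnergy β := by
    have hadd : ∀ k, ENNReal.ofReal ((weightedSeq α (k + 1) - weightedSeq α k) ^ 2) +
        ENNReal.ofReal ((weightedSeq β (k + 1) - weightedSeq β k) ^ 2) =
        ENNReal.ofReal ((weightedSeq α (k + 1) - weightedSeq α k) ^ 2 +
          (weightedSeq β (k + 1) - weightedSeq β k) ^ 2) := fun k =>
      (ENNReal.ofReal_add (sq_nonneg _) (sq_nonneg _)).symm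
    have hexp : ∀ k, (weightedSeq u (k + 1) - weightedSeq u k) ^ 2 =
        (weightedSeq α (k + 1) - weightedSeq α k) ^ 2 +
          (weightedSeq β (k + 1) - weightedSeq β k) ^ 2 -
          2 * (weightedSeq α k * weightedSeq β (k + 1) +
            weightedSeq β k * weightedSeq α (k + 1)) := fun k => by
      rw [hsum, weightedSeq_add, weightedSeq_add]
      linear_combination 2 * hαβ k + 2 * hαβ (k + 1)
    have hfin := hufin.ne
    rw [discreteEnergy] at hfin ⊢
    rw [discreteEnergy, discreteEnergy, ← ENNReal.tsum_add]
    -- The term with index `n + 1` couples the integers `n + 1` and `n + 2`, that is, `n.succPNat`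
    -- and `(n + 1).succPNat`; the inequality is strict there by `hcross`.
    refine ENNReal.tsum_lt_tsum (i := n + 1) hfin (fun k => ?_) ?_
    · rw [hadd, hexp]
      refine ENNReal.ofReal_le_ofReal ?_
      have := mul_nonneg (hα0 k) (hβ0 (k + 1))
      have := mul_nonneg (hβ0 k) (hα0 (k + 1))
      linarith
    · rw [hadd, hexp, ENNReal.ofReal_lt_ofReal_iff']
      have hpos : 0 < (weightedSeq α (n + 1 + 1) - weightedSeq α (n + 1)) ^ 2 +
          (weightedSeq β (n + 1 + 1) - weightedSeq β (n + 1)) ^ 2 := by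
        have := hexp (n + 1)
        have := sq_nonneg (weightedSeq u (n + 1 + 1) - weightedSeq u (n + 1))
        linarith
      exact ⟨by linarith, hpos⟩
  exact hlt.ne heq

theorem isIrreducibleForm_discreteEnergy {a : ℕ+ → ℝ} (ha : ∀ k, 0 < a k) :
    IsIrreducibleForm fun φ : Lp ℝ 2 (discreteMeasure a) => discreteEnergy φ := by
  intro A hA h
  have hall : ∀ n : ℕ, n.succPNat ∈ A ↔ (0 : ℕ).succPNat ∈ A := by
    intro n
    induction n with
    | zero => rfl
    | succ n ih => exact (h.succ_mem_iff ha n).symm.trans ih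
  have hall' : ∀ k : ℕ+, k ∈ A ↔ (0 : ℕ).succPNat ∈ A := fun k => by
    rw [← hall k.natPred, PNat.succPNat_natPred]
  by_cases h0 : (0 : ℕ).succPNat ∈ A
  · right
    have : Aᶜ = ∅ := compl_empty_iff.2 (eq_univ_of_forall fun k => (hall' k).2 h0)
    rw [this, measure_empty]
  · left
    have : A = ∅ := eq_empty_of_forall_notMem fun k hk => h0 ((hall' k).1 hk)
    rw [this, measure_empty]

/-! ### Transience -/

theorem sq_apply_le_toReal_discreteEnergy {φ : ℕ+ → ℝ} (h : discreteEnergy φ < ∞) (n : ℕ) :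
    (n + 1) * φ n.succPNat ^ 2 ≤ (discreteEnergy φ).toReal :=
  (sq_le_partialEnergy φ n).trans (partialEnergy_le_toReal h _)

theorem abs_apply_le_sqrt_discreteEnergy {φ : ℕ+ → ℝ} (h : discreteEnergy φ < ∞) (k : ℕ+) :
    |φ k| ≤ √(discreteEnergy φ).toReal := by
  refine Real.abs_le_sqrt ?_
  have h1 := sq_apply_le_toReal_discreteEnergy h k.natPred
  rw [PNat.succPNat_natPred] at h1
  nlinarith [mul_nonneg (Nat.cast_nonneg k.natPred : (0 : ℝ) ≤ k.natPred) (sq_nonneg (φ k))]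

theorem tsum_pnat_geometric : ∑' k : ℕ+, ENNReal.ofReal ((1 / 2) ^ (k : ℕ)) = 1 := by
  rw [← Equiv.pnatEquivNat.symm.tsum_eq]
  have h : ∀ n : ℕ, ENNReal.ofReal ((1 / 2) ^ ((Equiv.pnatEquivNat.symm n : ℕ+) : ℕ)) =
      2⁻¹ ^ (n + 1) := fun n => by
    rw [ENNReal.ofReal_pow (by norm_num), one_div, ENNReal.ofReal_inv_of_pos two_pos,
      ENNReal.ofReal_ofNat]
    rfl
  simp only [h, ENNReal.tsum_geometric_add_one, ENNReal.one_sub_inv_two, inv_inv]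
  exact ENNReal.inv_mul_cancel two_ne_zero ENNReal.ofNat_ne_top

theorem isTransientForm_discreteEnergy {a : ℕ+ → ℝ} (ha : ∀ k, 0 < a k) :
    IsTransientForm fun φ : Lp ℝ 2 (discreteMeasure a) => discreteEnergy φ := by
  -- The minimum with `1` gives boundedness, and dividing by `a k` gives `∑ a k * g k ≤ ∑ 2⁻ᵏ = 1`
  -- for arbitrary weights. With total mass at most one, the uniform bound `|u k| ≤ √q[u]`
  -- integrates without loss.
  set g : ℕ+ → ℝ := fun k => min 1 ((1 / 2) ^ (k : ℕ) / a k) with hg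
  have hgpos : ∀ k, 0 < g k := fun k => lt_min one_pos (div_pos (by positivity) (ha k))
  have hag : ∀ k, a k * g k ≤ (1 / 2) ^ (k : ℕ) := fun k => by
    have := mul_le_mul_of_nonneg_left (min_le_right 1 ((1 / 2 : ℝ) ^ (k : ℕ) / a k)) (ha k).le
    rwa [mul_div_cancel₀ _ (ha k).ne'] at this
  have hint : ∀ c : ℝ, 0 ≤ c → ∀ f : ℕ+ → ℝ, (∀ k, f k ≤ c * g k) →
      ∫⁻ k, ENNReal.ofReal (f k) ∂discreteMeasure a ≤ ENNReal.ofReal c := by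
    intro c hc f hf
    rw [lintegral_discreteMeasure, ← mul_one (ENNReal.ofReal c), ← tsum_pnat_geometric,
      ← ENNReal.tsum_mul_left]
    refine ENNReal.tsum_le_tsum fun k => ?_
    rw [← ENNReal.ofReal_mul (ha k).le, ← ENNReal.ofReal_mul hc]
    refine ENNReal.ofReal_le_ofReal ?_
    calc a k * f k ≤ a k * (c * g k) := mul_le_mul_of_nonneg_left (hf k) (ha k).le
      _ = c * (a k * g k) := by ring
      _ ≤ _ := mul_le_mul_of_nonneg_left (hag k) hc
  refine ⟨g, ⟨(measurable_of_countable _).aestronglyMeasurable, ?_⟩,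
    ⟨1, Eventually.of_forall fun k => min_le_left _ _⟩, Eventually.of_forall hgpos,
    fun u hu => ?_⟩
  · rw [hasFiniteIntegral_iff_ofReal (Eventually.of_forall fun k => (hgpos k).le)]
    exact (hint 1 zero_le_one g fun k => (one_mul _).ge).trans_lt ENNReal.ofReal_lt_top
  · have h := hint (√(discreteEnergy u).toReal) (Real.sqrt_nonneg _) (fun k => |u k| * g k)
      fun k => mul_le_mul_of_nonneg_right (abs_apply_le_sqrt_discreteEnergy hu k) (hgpos k).le
    refine (pow_le_pow_left' h 2).trans_eq ?_
    rw [← ENNReal.ofReal_pow (Real.sqrt_nonneg _), Real.sq_sqrt ENNReal.toReal_nonneg,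
      ENNReal.ofReal_toReal hu.ne]

/-! ### The approximating forms -/

theorem natCast_mul_eq_weightedSeq {φ : ℕ+ → ℝ} {f : ℝ → ℝ} (h : restrictNat f = φ) (j : ℕ) :
    j * f j = weightedSeq φ j := by
  cases j with
  | zero => simp [weightedSeq]
  | succ j => rw [weightedSeq_succ, ← h]; rfl

theorem sq_sqrt_two_mul_div_two {l : ℝ} (hl : 0 < l) : √(2 * l) ^ 2 / 2 = l := by
  rw [Real.sq_sqrt (by positivity)]
  ring

/-- Every projection `v` competing in the infimum has the values of `φ` at the positive integers, so
the lower bound by interpolants applies to it, with `κ = √(2 l)`. -/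
theorem interpolantEnergy_le_approxTraceForm {a : ℕ+ → ℝ} (ha : ∀ k, 0 < a k) {l : ℝ} (hl : 0 < l)
    (φ : Lp ℝ 2 (discreteMeasure a)) (N : ℕ) :
    ENNReal.ofReal (interpolantEnergy √(2 * l) N fun j =>
      if j ≤ N then weightedSeq φ j else Real.exp (-√(2 * l)) * weightedSeq φ N) ≤
      approxTraceForm a l φ := by
  refine le_iInf fun u => le_iInf fun v => le_iInf fun hu => le_iInf fun huφ => le_iInf fun hp =>
    ENNReal.ofReal_le_ofReal ?_
  have hκ : 0 < √(2 * l) := Real.sqrt_pos.2 (by positivity)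
  have hl' := sq_sqrt_two_mul_div_two hl
  have hv : restrictNat v = φ := by
    rw [IsProjection.restrictNat_eq hκ hu.mem (hl'.symm ▸ hp), ← huφ]
    exact (funext (toLp_apply ha hu.sq)).symm
  have h := interpolantEnergy_le_besselForm hκ hp.1.1 N
  rw [hl'] at h
  simpa only [natCast_mul_eq_weightedSeq hv] using h

/-- The interpolant is orthogonal to the kernel of `J`, hence its own projection, and it competes in
the infimum as both `u` and `v`. -/
theorem approxTraceForm_le_interpolantEnergy {a : ℕ+ → ℝ} (ha : ∀ k, 0 < a k) {l : ℝ} (hl : 0 < l)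
    (φ : Lp ℝ 2 (discreteMeasure a)) {N : ℕ} (hN : ∀ j, N ≤ j → weightedSeq φ j = 0) :
    approxTraceForm a l φ ≤ ENNReal.ofReal (interpolantEnergy √(2 * l) N (weightedSeq φ)) := by
  have hκ : 0 < √(2 * l) := Real.sqrt_pos.2 (by positivity)
  have hl' := sq_sqrt_two_mul_div_two hl
  set v := resolventInterpolant √(2 * l) N (weightedSeq φ)
  have hval := resolventInterpolant_of_support hκ (rfl : weightedSeq φ 0 = 0) hN
  have hv : restrictNat v = φ := by
    funext k
    obtain ⟨n, rfl⟩ : ∃ n : ℕ, k = n.succPNat := ⟨k.natPred, (PNat.succPNat_natPred k).symm⟩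
    exact mul_left_cancel₀ (by positivity : ((n + 1 : ℕ) : ℝ) ≠ 0) (hval (n + 1))
  have hdom := besselDomain_resolventInterpolant hκ N (weightedSeq φ)
  have hJ : DomJ a v := ⟨hdom, by rw [hv]; exact Lp.memLp φ⟩
  have hJφ : hJ.sq.toLp (restrictNat v) = φ :=
    Lp.ext (Eventually.of_forall fun k => by rw [toLp_apply ha, hv])
  have horth := kerJOrth_resolventInterpolant hκ N (weightedSeq φ)
  have henergy := besselForm_resolventInterpolant hκ hdom N (weightedSeq φ) fun j _ => hval j
  rw [hl'] at horth henergy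
  rw [← henergy]
  exact iInf_le_of_le v <| iInf_le_of_le v <| iInf_le_of_le hJ <| iInf_le_of_le hJφ <|
    iInf_le_of_le horth.isProjection_self le_rfl

theorem tendsto_sqrt_two_mul {l : ℕ → ℝ} (hl0 : Tendsto l atTop (𝓝 0)) :
    Tendsto (fun n => √(2 * l n)) atTop (𝓝 0) := by
  simpa using (hl0.const_mul 2).sqrt

/-- The `liminf` inequality. -/
theorem discreteEnergy_le_liminf_approxTraceForm {a : ℕ+ → ℝ} (ha : ∀ k, 0 < a k) {l : ℕ → ℝ}
    (hl : ∀ n, 0 < l n) (hl0 : Tendsto l atTop (𝓝 0)) {φ : ℕ → Lp ℝ 2 (discreteMeasure a)}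
    {φ₀ : Lp ℝ 2 (discreteMeasure a)} (h : ∀ k, Tendsto (fun n => φ n k) atTop (𝓝 (φ₀ k))) :
    discreteEnergy φ₀ ≤ liminf (fun n => approxTraceForm a (l n) (φ n)) atTop := by
  rw [discreteEnergy_eq_iSup]
  refine iSup_le fun N => ?_
  have hw : ∀ j, Tendsto (fun n => weightedSeq (φ n) j) atTop (𝓝 (weightedSeq φ₀ j)) := by
    rintro (_ | j)
    · exact tendsto_const_nhds
    · exact (h _).const_mul _
  have hκ := tendsto_sqrt_two_mul hl0
  have hexp : Tendsto (fun n => Real.exp (-√(2 * l n))) atTop (𝓝 1) := by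
    simpa [Function.comp_def] using (Real.continuous_exp.tendsto _).comp hκ.neg
  have hlim := tendsto_interpolantEnergy (fun n => Real.sqrt_pos.2 (mul_pos two_pos (hl n))) hκ
    (w := fun n j => if j ≤ N then weightedSeq (φ n) j else
      Real.exp (-√(2 * l n)) * weightedSeq (φ n) N)
    -- The limit data are constant from `N` to `N + 1`, because `exp(-κ) → 1`; this kills the
    -- boundary term `w₀ N * (w₀ N - w₀ (N + 1))`.
    (w₀ := fun j => if j ≤ N then weightedSeq φ₀ j else weightedSeq φ₀ N)
    (by simp [weightedSeq]) (N := N) fun j _ => by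
      by_cases hj : j ≤ N
      · simpa only [if_pos hj] using hw j
      · simpa only [if_neg hj, one_mul] using hexp.mul (hw N)
  have hval : ∑ k ∈ Finset.range N, ((if k + 1 ≤ N then weightedSeq φ₀ (k + 1) else
      weightedSeq φ₀ N) - if k ≤ N then weightedSeq φ₀ k else weightedSeq φ₀ N) ^ 2 =
      partialEnergy φ₀ N :=
    Finset.sum_congr rfl fun k hk => by
      have := Finset.mem_range.1 hk
      rw [if_pos (by omega), if_pos (by omega)]
  simp only [hval, le_refl, if_true, if_neg (Nat.not_succ_le_self N), sub_self, mul_zero,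
    add_zero] at hlim
  rw [← (ENNReal.tendsto_ofReal hlim).liminf_eq]
  exact liminf_le_liminf (Eventually.of_forall fun n =>
    interpolantEnergy_le_approxTraceForm ha (hl n) (φ n) N)

/-- For finitely supported functions the approximating forms converge. -/
theorem eventually_approxTraceForm_le {a : ℕ+ → ℝ} (ha : ∀ k, 0 < a k) {l : ℕ → ℝ}
    (hl : ∀ n, 0 < l n) (hl0 : Tendsto l atTop (𝓝 0)) {φ : Lp ℝ 2 (discreteMeasure a)} {N : ℕ}
    (hN : ∀ k : ℕ, N ≤ k → φ k.succPNat = 0) {c : ℝ≥0∞} (hc : discreteEnergy φ < c) :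
    ∀ᶠ n in atTop, approxTraceForm a (l n) φ ≤ c := by
  have hw : ∀ j, N + 1 ≤ j → weightedSeq φ j = 0 := by
    rintro (_ | j) hj
    · rfl
    · rw [weightedSeq_succ, hN j (by omega), mul_zero]
  have hlim := tendsto_interpolantEnergy (fun n => Real.sqrt_pos.2 (mul_pos two_pos (hl n)))
    -- The shift to `N + 1` arises because `φ` vanishes at `k.succPNat = k + 1` for `k ≥ N`, so the
    -- weighted sequence vanishes from `N + 1` on.
    (tendsto_sqrt_two_mul hl0) (w := fun _ => weightedSeq φ) rfl (N := N + 1)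
    fun j _ => tendsto_const_nhds
  rw [hw (N + 1) le_rfl, zero_mul, add_zero] at hlim
  have hlt : ENNReal.ofReal (∑ k ∈ Finset.range (N + 1),
      (weightedSeq φ (k + 1) - weightedSeq φ k) ^ 2) < c :=
    (ofReal_partialEnergy_le φ (N + 1)).trans_lt hc
  filter_upwards [(ENNReal.tendsto_ofReal hlim).eventually_lt_const hlt] with n hn
  exact (approxTraceForm_le_interpolantEnergy ha (hl n) φ hw).trans hn.le

/-- Functions of finite energy are approximated by finitely supported ones without increasing the
energy. -/
theorem exists_soft_thresholds {a : ℕ+ → ℝ} (ha : ∀ k, 0 < a k) {φ : Lp ℝ 2 (discreteMeasure a)}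
    (hφ : discreteEnergy φ < ∞) :
    ∃ ψ : ℕ → Lp ℝ 2 (discreteMeasure a), Tendsto ψ atTop (𝓝 φ) ∧
      ∀ n, discreteEnergy (ψ n) ≤ discreteEnergy φ ∧
        ∃ N : ℕ, ∀ k : ℕ, N ≤ k → ψ n k.succPNat = 0 := by
  set ε : ℕ → ℝ := fun n => 1 / ((n : ℝ) + 1) with hε
  have hεpos : ∀ n, 0 < ε n := fun n => by positivity
  -- Soft thresholding at level `ε n`. Unlike sharp truncation to finitely many integers, it is a
  -- normal contraction and cannot raise the energy.
  set T : ℕ → ℝ → ℝ := fun n x => x - max (-ε n) (min x (ε n)) with hT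
  have hTle : ∀ n x, |T n x| ≤ |x| := fun n x => by
    have := hεpos n
    simp only [hT]
    grind
  have hTsub : ∀ n x y, |T n x - T n y| ≤ |x - y| := fun n x y => by
    have := hεpos n
    simp only [hT]
    grind
  have hTε : ∀ n x, |T n x - x| ≤ ε n := fun n x => by
    have := hεpos n
    simp only [hT]
    grind
  have hmem : ∀ n, MemLp (fun k => T n (φ k)) 2 (discreteMeasure a) := fun n =>
    (Lp.memLp φ).mono (measurable_of_countable _).aestronglyMeasurable
      (Eventually.of_forall fun k => hTle n (φ k))
  refine ⟨fun n => (hmem n).toLp _, tendsto_Lp_of_dominated ha (fun n k => ?_) fun k => ?_,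
    fun n => ⟨?_, ?_⟩⟩
  · rw [toLp_apply ha]
    exact hTle n _
  · simp only [toLp_apply ha]
    rw [tendsto_iff_norm_sub_tendsto_zero]
    exact squeeze_zero (fun _ => norm_nonneg _) (fun n => hTε n _)
      tendsto_one_div_add_atTop_nhds_zero_nat
  · refine discreteEnergy_le_of_contraction (fun k => ?_) fun j k => ?_
    · rw [toLp_apply ha]
      exact hTle n _
    · rw [toLp_apply ha, toLp_apply ha]
      exact hTsub n _ _
  -- Since `(k + 1) φ(k + 1)²` is at most the energy, `|φ|` is below the threshold once `k` exceeds
  -- the energy over `ε n ^ 2`.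
  · obtain ⟨N, hN⟩ := exists_nat_ge ((discreteEnergy φ).toReal / ε n ^ 2)
    refine ⟨N, fun k hk => ?_⟩
    rw [toLp_apply ha]
    have h1 := sq_apply_le_toReal_discreteEnergy hφ k
    rw [div_le_iff₀ (pow_pos (hεpos n) 2)] at hN
    have hk' : (N : ℝ) ≤ k := by exact_mod_cast hk
    have h2 : ((k : ℝ) + 1) * φ k.succPNat ^ 2 ≤ (k + 1) * ε n ^ 2 := by
      nlinarith [sq_nonneg (ε n)]
    have h3 : |φ k.succPNat| ≤ ε n :=
      abs_le_of_sq_le_sq (le_of_mul_le_mul_left h2 (by positivity)) (hεpos n).le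
    obtain ⟨h4, h5⟩ := abs_le.1 h3
    simp only [hT]
    rw [min_eq_left h5, max_eq_right h4, sub_self]

/-! ### Mosco convergence and uniqueness of the limit -/

/-- A diagonal sequence along which countably many eventual properties hold. -/
theorem exists_tendsto_atTop_eventually {P : ℕ → ℕ → Prop} (h : ∀ N, ∀ᶠ n in atTop, P N n) :
    ∃ f : ℕ → ℕ, Tendsto f atTop atTop ∧ ∀ᶠ n in atTop, P (f n) n := by
  classical
  choose M hM using fun N => eventually_atTop.1 (h N)
  refine ⟨fun n => Nat.findGreatest (fun N => M N ≤ n) n, ?_, ?_⟩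
  · refine tendsto_atTop.2 fun N => ?_
    filter_upwards [eventually_ge_atTop N, eventually_ge_atTop (M N)] with n h1 h2
    exact Nat.le_findGreatest h1 h2
  · filter_upwards [eventually_ge_atTop (M 0)] with n hn
    exact hM _ _ (Nat.findGreatest_spec (P := fun N => M N ≤ n) (Nat.zero_le n) hn)

theorem isTraceForm_discreteEnergy {a : ℕ+ → ℝ} (ha : ∀ k, 0 < a k) :
    IsTraceForm a fun φ => discreteEnergy φ := by
  intro l hl hl0
  refine ⟨fun φ φ₀ h => discreteEnergy_le_liminf_approxTraceForm ha hl hl0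
    (tendsto_apply_of_tendsto_inner ha h), fun φ₀ => ?_⟩
  rcases eq_or_ne (discreteEnergy φ₀) ∞ with htop | hfin
  · exact ⟨fun _ => φ₀, tendsto_const_nhds, by simp [htop]⟩
  obtain ⟨ψ, hψ, hψ'⟩ := exists_soft_thresholds ha (lt_top_iff_ne_top.2 hfin)
  -- The slack `(N + 1)⁻¹` makes the inequality strict, so that it holds eventually for each fixed
  -- truncation; it vanishes along the diagonal sequence.
  have hev : ∀ N : ℕ, ∀ᶠ n in atTop,
      approxTraceForm a (l n) (ψ N) ≤ discreteEnergy φ₀ + ((N : ℝ≥0∞) + 1)⁻¹ := fun N => by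
    obtain ⟨hle, K, hK⟩ := hψ' N
    exact eventually_approxTraceForm_le ha hl hl0 hK
      (hle.trans_lt (ENNReal.lt_add_right hfin (by simp)))
  obtain ⟨f, hf, hfev⟩ := exists_tendsto_atTop_eventually hev
  refine ⟨fun n => ψ (f n), hψ.comp hf, ?_⟩
  have hz : Tendsto (fun n => discreteEnergy φ₀ + ((f n : ℝ≥0∞) + 1)⁻¹) atTop
      (𝓝 (discreteEnergy φ₀)) := by
    have h1 : Tendsto (fun N : ℕ => ((N : ℝ≥0∞) + 1)⁻¹) atTop (𝓝 0) := by
      have := ENNReal.tendsto_inv_nat_nhds_zero.comp (tendsto_add_atTop_nat 1)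
      simpa [Function.comp_def] using this
    simpa using (h1.comp hf).const_add (discreteEnergy φ₀)
  exact (limsup_le_limsup hfev).trans_eq hz.limsup_eq

/-- A recovery sequence for `q'` converges strongly, hence weakly, and so is admissible in the
liminf inequality for `q`. -/
theorem IsMoscoLimit.le {H : Type*} [NormedAddCommGroup H] [InnerProductSpace ℝ H]
    {Q : ℝ → H → ℝ≥0∞} {q q' : H → ℝ≥0∞} (h : IsMoscoLimit Q q) (h' : IsMoscoLimit Q q') (x : H) :
    q x ≤ q' x := by
  have hpos : ∀ n : ℕ, 0 < 1 / ((n : ℝ) + 1) := fun n => by positivity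
  obtain ⟨φ, hφ, hle⟩ := (h' _ hpos tendsto_one_div_add_atTop_nhds_zero_nat).2 x
  have hge := (h _ hpos tendsto_one_div_add_atTop_nhds_zero_nat).1 φ x
    fun ψ => hφ.inner tendsto_const_nhds
  exact hge.trans (le_trans liminf_le_limsup hle)

theorem IsMoscoLimit.unique {H : Type*} [NormedAddCommGroup H] [InnerProductSpace ℝ H]
    {Q : ℝ → H → ℝ≥0∞} {q q' : H → ℝ≥0∞} (h : IsMoscoLimit Q q) (h' : IsMoscoLimit Q q') :
    q = q' :=
  funext fun x => le_antisymm (h.le h' x) (h'.le h x)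

end

theorem mainTheorem5 (a : ℕ+ → ℝ) (ha : ∀ k, 0 < a k) :
    ∃ q : Lp ℝ 2 (discreteMeasure a) → ℝ≥0∞,
      IsTraceForm a q ∧
      (∀ q' : Lp ℝ 2 (discreteMeasure a) → ℝ≥0∞, IsTraceForm a q' → q' = q) ∧
      IsDirichletForm q ∧
      IsIrreducibleForm q ∧
      IsTransientForm q :=
  ⟨fun φ => discreteEnergy φ, isTraceForm_discreteEnergy ha,
    fun _ h => IsMoscoLimit.unique h (isTraceForm_discreteEnergy ha),
    isDirichletForm_discreteEnergy ha, isIrreducibleForm_discreteEnergy ha,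
    isTransientForm_discreteEnergy ha⟩
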